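/- Let $K$ be a nonempty locally compact Hausdorff space, $M(K)$ the space of regular complex Borel measures on $K$, $M^+(K)$ its cone of non-negative measures with the cone topology (the weakest topology making $\mu\mapsto\mu(K)$ and $\mu\mapsto\int f\,d\mu$, $0\le f\in C_c(K)$, continuous), and $p_x$ the point mass at $x$. Let $(K,*)$ be a semitopological semihypergroup: $*$ is an associative bilinear product on $M(K)$ that maps $M^+(K)\times M^+(K)$ into $M^+(K)$ and is separately continuous there; for all $x,y\in K$ the measure $p_x*p_y$ is a probability measure with compact support; and $(x,y)\mapsto\operatorname{supp}(p_x*p_y)$ is continuous from $K\times K$ into the compact subsets of $K$ with the Michael (Vietoris) topology. Put $L_xf(y)=\int_K f\,d(p_x*p_y)$. Let $AP(K)$ be the space of those bounded continuous $f:K\to\mathbb C$ for which $\{L_xf:x\in K\}$ is relatively compact in the space of bounded continuous functions with the supremum norm. $AP(K)$ is called left amenable if there is $m\in AP(K)^*$ with $\|m\|=m(1)=1$ and $m(L_xf)=m(f)$ for all $x\in K$, $f\in AP(K)$ (where $L_xf\in AP(K)$). Let $X$ be a complex Banach space and give $X^*$ the weak$^*$ topology. An action of $K$ on $X^*$ is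 a map $\pi:K\times X^*\to X^*$, $\pi_s:=\pi(s,\cdot)$, such that $\pi(s,\pi(t,u))=\int_K\pi(\zeta,u)\,d(p_s*p_t)(\zeta)$ for all $s,t\in K$, $u\in X^*$ (the integral being taken weak$^*$, i.e. after evaluation at each $\varphi\in X$), and $\pi(e,u)=u$ for all $u$ whenever $e$ is a two-sided identity of $K$. It is separately continuous if it is so for the weak$^*$ topology; affine if every $\pi_s$ preserves convex combinations; and equicontinuous if for every weak$^*$-compact $C\subseteq X^*$, every $x\in C$ and every weak$^*$-neighbourhood $U$ of $0$ there is a weak$^*$-neighbourhood $V$ of $0$ such that $\pi(s,y)-\pi(s,x)\in U$ for all $s\in K$ and all $y\in C$ with $y-x\in V$. Theorem. $AP(K)$ is left amenable if and only if every separately continuous, equicontinuous, affine action $\pi$ of $K$ on a dual Banach space $X^*$ for which there is $\omega_0\in X^*$ with $\{\pi(s,\omega_0):s\in K\}$ norm bounded has a common fixed point, i.e. a point $x_0\in X^*$ with $\pi(s,x_0)=x_0$ for all $s\in K$. -/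

import Mathlib

open MeasureTheory Topology
open scoped Pointwise NNReal ENNReal BoundedContinuousFunction

universe u v

/-! ### Regular complex measures -/

theorem SHG.regular_of_le {K : Type*} [TopologicalSpace K] [T2Space K] [MeasurableSpace K]
    [BorelSpace K] {ρ ν : Measure K} [IsFiniteMeasure ν] [ν.InnerRegularCompactLTTop]
    (h : ρ ≤ ν) : ρ.Regular := by
  have : IsFiniteMeasure ρ := isFiniteMeasure_of_le ν h
  have : ρ.InnerRegularCompactLTTop := by
    refine ⟨fun A hA r hr => ?_⟩
    obtain ⟨C, hCA, hC, hlt⟩ := hA.1.exists_isCompact_sdiff_lt (measure_ne_top ν A)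
      (tsub_pos_of_lt hr).ne'
    refine ⟨C, hCA, hC, ?_⟩
    by_contra! hle
    have h1 : ρ A ≤ ρ C + ρ (A \ C) := by
      calc ρ A ≤ ρ (C ∪ A \ C) := measure_mono (by simp)
        _ ≤ _ := measure_union_le _ _
    have h2 : ρ (A \ C) < ρ A - r := (h _).trans_lt hlt
    have h3 : r + ρ (A \ C) < r + (ρ A - r) :=
      ENNReal.add_lt_add_left (hr.trans_le le_top).ne h2
    rw [add_tsub_cancel_of_le hr.le] at h3
    exact absurd (h1.trans (add_le_add_left hle _)) (not_le.mpr h3)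
  infer_instance

theorem SHG.isFiniteMeasure_variation {K : Type*} [MeasurableSpace K] (μ : ComplexMeasure K) :
    IsFiniteMeasure μ.variation := by
  have h : μ.variation ≤ (ComplexMeasure.re μ).totalVariation
      + (ComplexMeasure.im μ).totalVariation := by
    refine VectorMeasure.variation_le_of_forall_enorm_le fun E _ => ?_
    have h1 := SignedMeasure.enorm_le_totalVariation (ComplexMeasure.re μ) E
    have h2 := SignedMeasure.enorm_le_totalVariation (ComplexMeasure.im μ) E
    rw [Measure.add_apply]
    refine le_trans ?_ (add_le_add h1 h2)
    have h3 : μ E = (((ComplexMeasure.re μ E : ℝ) : ℂ))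
        + ((ComplexMeasure.im μ E : ℝ) : ℂ) * Complex.I := by
      exact (Complex.re_add_im (μ E)).symm
    rw [h3]
    refine (enorm_add_le _ _).trans ?_
    simp [← ofReal_norm]
  have h4 : IsFiniteMeasure ((ComplexMeasure.re μ).totalVariation
      + (ComplexMeasure.im μ).totalVariation) := by
    unfold SignedMeasure.totalVariation
    infer_instance
  exact isFiniteMeasure_of_le _ h

/-- `M(K)`: the space of regular complex Borel measures on `K`, i.e. of the complex measures whose
total variation is a regular measure. -/
noncomputable def RegularComplexMeasure (K : Type*) [TopologicalSpace K] [T2Space K]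
    [MeasurableSpace K] [BorelSpace K] : Submodule ℂ (ComplexMeasure K) where
  carrier := {μ | μ.variation.Regular}
  zero_mem' := by
    change (0 : ComplexMeasure K).variation.Regular
    rw [VectorMeasure.variation_zero]
    infer_instance
  add_mem' := by
    intro μ ν hμ hν
    have : μ.variation.Regular := hμ
    have : ν.variation.Regular := hν
    have := SHG.isFiniteMeasure_variation μ
    have := SHG.isFiniteMeasure_variation ν
    exact SHG.regular_of_le (ν := μ.variation + ν.variation) VectorMeasure.variation_add_le
  smul_mem' := by
    intro c μ hμ
    have : μ.variation.Regular := hμ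
    change (c • μ).variation.Regular
    rw [VectorMeasure.variation_smul]
    infer_instance

/-- The point mass `p_x`. -/
noncomputable def pointMass {K : Type*} [TopologicalSpace K] [T2Space K]
    [MeasurableSpace K] [BorelSpace K] (x : K) : RegularComplexMeasure K :=
  ⟨VectorMeasure.dirac x 1, by
    change (VectorMeasure.dirac x (1 : ℂ)).variation.Regular
    rw [VectorMeasure.variation_dirac]
    have : (Measure.dirac x).InnerRegularCompactLTTop := by
      refine ⟨fun A hA r hr => ?_⟩
      by_cases hx : x ∈ A
      · refine ⟨{x}, by simpa using hx, isCompact_singleton, ?_⟩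
        have h1 := Measure.dirac_apply_of_mem hx
        rw [h1] at hr
        simpa using hr
      · rw [Measure.dirac_apply' _ hA.1] at hr
        simp [hx] at hr
    have : (Measure.dirac x).Regular := inferInstance
    simpa using this⟩

/-- A complex measure is non-negative if it takes real values `≥ 0`. -/
def IsNonnegMeasure {K : Type*} [MeasurableSpace K] (μ : ComplexMeasure K) : Prop :=
  ∀ A : Set K, MeasurableSet A → 0 ≤ (μ A).re ∧ (μ A).im = 0

theorem isNonnegMeasure_pointMass {K : Type*} [TopologicalSpace K] [T2Space K]
    [MeasurableSpace K] [BorelSpace K] (x : K) :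
    IsNonnegMeasure (pointMass x : ComplexMeasure K) := by
  intro A hA
  by_cases hx : x ∈ A
  · have h : (pointMass x : ComplexMeasure K) A = 1 := VectorMeasure.dirac_apply_of_mem hA hx
    simp [h]
  · have h : (pointMass x : ComplexMeasure K) A = 0 := VectorMeasure.dirac_apply_of_notMem hx
    simp [h]

/-- `M⁺(K)`: the finite non-negative regular Borel measures on `K`, as elements of `M(K)`. -/
structure PositiveRegularMeasure (K : Type*) [TopologicalSpace K] [T2Space K]
    [MeasurableSpace K] [BorelSpace K] where
  val : RegularComplexMeasure K
  nonneg : IsNonnegMeasure (val : ComplexMeasure K)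

/-- A non-negative complex measure agrees with its total variation; so for such measures the total
variation is just the same measure, seen as a Mathlib `Measure`. -/
theorem IsNonnegMeasure.variation_apply {K : Type*} [MeasurableSpace K] {μ : ComplexMeasure K}
    (h : IsNonnegMeasure μ) {A : Set K} (hA : MeasurableSet A) :
    μ.variation A = ENNReal.ofReal (μ A).re := by
  have hnorm : ∀ E, MeasurableSet E → ‖μ E‖ₑ = ENNReal.ofReal (μ E).re := by
    intro E hE
    have h1 : μ E = (((μ E).re : ℝ) : ℂ) := Complex.ext (by simp) (by simp [(h E hE).2])
    rw [h1, ← ofReal_norm, Complex.norm_real, Real.norm_of_nonneg (h E hE).1, Complex.ofReal_re]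
  apply le_antisymm
  · have h0 : VectorMeasure.restrict (0 : SignedMeasure K) Set.univ
        ≤ VectorMeasure.restrict (ComplexMeasure.re μ) Set.univ := by
      refine VectorMeasure.restrict_le_restrict_of_subset_le _ _ fun E hE _ => ?_
      exact (h E hE).1
    let m : Measure K := (ComplexMeasure.re μ).toMeasureOfZeroLE Set.univ MeasurableSet.univ h0
    have hm : ∀ E, MeasurableSet E → m E = ENNReal.ofReal (μ E).re := by
      intro E hE
      simp only [m]
      rw [SignedMeasure.toMeasureOfZeroLE_apply _ _ _ hE]
      simp [ENNReal.ofReal, Real.toNNReal, max_eq_left (h E hE).1]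
      rfl
    rw [← hm A hA]
    exact VectorMeasure.variation_apply_le_of_forall_enorm_le hA
      fun E hE _ => by rw [hnorm E hE, hm E hE]
  · rw [← hnorm A hA]
    exact VectorMeasure.enorm_measure_le_variation μ A

/-- A non-negative element of `M(K)` as a Mathlib measure. -/
noncomputable def PositiveRegularMeasure.toMeasure {K : Type*} [TopologicalSpace K] [T2Space K]
    [MeasurableSpace K] [BorelSpace K] (μ : PositiveRegularMeasure K) : Measure K :=
  (μ.val : ComplexMeasure K).variation

/-- The cone topology on `M⁺(K)`: the weakest topology for which `μ ↦ ∫ f dμ` is continuous for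
each continuous `f ≥ 0` with compact support and `μ ↦ μ(K)` is continuous. -/
noncomputable instance PositiveRegularMeasure.instTopologicalSpace {K : Type*}
    [TopologicalSpace K] [T2Space K] [MeasurableSpace K] [BorelSpace K] :
    TopologicalSpace (PositiveRegularMeasure K) :=
  TopologicalSpace.induced
    (fun μ : PositiveRegularMeasure K =>
      ((fun f : CompactlySupportedContinuousMap K ℝ≥0 => ∫ x, (f x : ℝ) ∂μ.toMeasure),
        μ.toMeasure.real Set.univ))
    (inferInstance : TopologicalSpace ((CompactlySupportedContinuousMap K ℝ≥0 → ℝ) × ℝ))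

/-! ### Semitopological semihypergroups -/

/-- A semitopological semihypergroup structure on a locally compact Hausdorff space `K`: an
associative bilinear product (convolution) on `M(K)` which is positive and separately continuous on
`M⁺(K)`, such that `p_x * p_y` is a probability measure with compact support, and such that
`(x, y) ↦ supp (p_x * p_y)` is continuous into the compact subsets of `K` with the Michael
(Vietoris) topology. -/
structure SemitopologicalSemihypergroup (K : Type*) [TopologicalSpace K] [T2Space K]
    [LocallyCompactSpace K] [MeasurableSpace K] [BorelSpace K] where
  conv : RegularComplexMeasure K →ₗ[ℂ] RegularComplexMeasure K →ₗ[ℂ] RegularComplexMeasure K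
  conv_assoc : ∀ μ ν ω, conv (conv μ ν) ω = conv μ (conv ν ω)
  conv_nonneg : ∀ μ ν : PositiveRegularMeasure K,
    IsNonnegMeasure (conv μ.val ν.val : ComplexMeasure K)
  continuous_conv_left : ∀ ω : PositiveRegularMeasure K,
    Continuous fun μ : PositiveRegularMeasure K =>
      PositiveRegularMeasure.mk (conv ω.val μ.val) (conv_nonneg ω μ)
  continuous_conv_right : ∀ ω : PositiveRegularMeasure K,
    Continuous fun μ : PositiveRegularMeasure K =>
      PositiveRegularMeasure.mk (conv μ.val ω.val) (conv_nonneg μ ω)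
  conv_pointMass_univ : ∀ x y : K,
    (conv (pointMass x) (pointMass y) : ComplexMeasure K) Set.univ = 1
  isCompact_support : ∀ x y : K,
    IsCompact (conv (pointMass x) (pointMass y) : ComplexMeasure K).variation.support
  continuous_support : Continuous fun p : K × K =>
    (⟨(conv (pointMass p.1) (pointMass p.2) : ComplexMeasure K).variation.support,
      isCompact_support p.1 p.2⟩ : TopologicalSpace.Compacts K)

namespace SemitopologicalSemihypergroup

theorem nonneg_conv_pointMass {K : Type*} [TopologicalSpace K] [T2Space K]
    [LocallyCompactSpace K] [MeasurableSpace K] [BorelSpace K]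
    (S : SemitopologicalSemihypergroup K) (x y : K) :
    IsNonnegMeasure (S.conv (pointMass x) (pointMass y) : ComplexMeasure K) :=
  S.conv_nonneg ⟨pointMass x, isNonnegMeasure_pointMass x⟩ ⟨pointMass y, isNonnegMeasure_pointMass y⟩

/-- The probability measure `p_x * p_y`. -/
noncomputable def convMeasure {K : Type*} [TopologicalSpace K] [T2Space K]
    [LocallyCompactSpace K] [MeasurableSpace K] [BorelSpace K]
    (S : SemitopologicalSemihypergroup K) (x y : K) : Measure K :=
  PositiveRegularMeasure.toMeasure
    ⟨S.conv (pointMass x) (pointMass y), S.nonneg_conv_pointMass x y⟩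

instance {K : Type*} [TopologicalSpace K] [T2Space K]
    [LocallyCompactSpace K] [MeasurableSpace K] [BorelSpace K]
    (S : SemitopologicalSemihypergroup K) (x y : K) : IsProbabilityMeasure (S.convMeasure x y) where
  measure_univ := by
    have h := (S.nonneg_conv_pointMass x y).variation_apply MeasurableSet.univ
    rw [S.conv_pointMass_univ] at h
    simpa [convMeasure, PositiveRegularMeasure.toMeasure] using h

/-- `e` is a two-sided identity: `p_x * p_e = p_e * p_x = p_x` for every `x`. -/
def IsTwoSidedIdentity {K : Type*} [TopologicalSpace K] [T2Space K]
    [LocallyCompactSpace K] [MeasurableSpace K] [BorelSpace K]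
    (S : SemitopologicalSemihypergroup K) (e : K) : Prop :=
  ∀ x : K, S.conv (pointMass x) (pointMass e) = pointMass x ∧
    S.conv (pointMass e) (pointMass x) = pointMass x

/-- The left translate `L_x f (y) = ∫ f d(p_x * p_y)`. -/
noncomputable def leftTranslate {K : Type*} [TopologicalSpace K] [T2Space K]
    [LocallyCompactSpace K] [MeasurableSpace K] [BorelSpace K]
    (S : SemitopologicalSemihypergroup K) (x : K) (f : K → ℂ) : K → ℂ :=
  fun y => ∫ z, f z ∂(S.convMeasure x y)

/-- `AP(K)`: the bounded continuous functions `f` whose left orbit `{L_x f : x ∈ K}` is relatively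
compact in the space of bounded continuous functions on `K` with the supremum norm, that is,
contained in a compact set of bounded continuous functions. -/
noncomputable def AP {K : Type*} [TopologicalSpace K] [T2Space K]
    [LocallyCompactSpace K] [MeasurableSpace K] [BorelSpace K]
    (S : SemitopologicalSemihypergroup K) : Submodule ℂ (K →ᵇ ℂ) where
  carrier := {f | ∃ C : Set (K →ᵇ ℂ), IsCompact C ∧ ∀ x, ∃ g ∈ C, ⇑g = S.leftTranslate x f}
  zero_mem' := ⟨{0}, isCompact_singleton, fun x => ⟨0, rfl, by
    ext y; simp [leftTranslate]⟩⟩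
  add_mem' := by
    rintro f f' ⟨C, hC, h⟩ ⟨C', hC', h'⟩
    refine ⟨C + C', hC.add hC', fun x => ?_⟩
    obtain ⟨g, hg, hgx⟩ := h x
    obtain ⟨g', hg', hgx'⟩ := h' x
    refine ⟨g + g', Set.add_mem_add hg hg', ?_⟩
    ext y
    have h1 : Integrable f (S.convMeasure x y) := f.integrable _
    have h2 : Integrable f' (S.convMeasure x y) := f'.integrable _
    simp only [BoundedContinuousFunction.coe_add, Pi.add_apply, hgx, hgx', leftTranslate]
    exact (integral_add h1 h2).symm
  smul_mem' := by
    rintro c f ⟨C, hC, h⟩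
    refine ⟨c • C, hC.smul c, fun x => ?_⟩
    obtain ⟨g, hg, hgx⟩ := h x
    refine ⟨c • g, Set.smul_mem_smul_set hg, ?_⟩
    ext y
    simp only [BoundedContinuousFunction.coe_smul, hgx, leftTranslate]
    exact (integral_smul c _).symm

/-- The constant function `1` is almost periodic. -/
theorem one_mem_AP {K : Type*} [TopologicalSpace K] [T2Space K]
    [LocallyCompactSpace K] [MeasurableSpace K] [BorelSpace K]
    (S : SemitopologicalSemihypergroup K) : (1 : K →ᵇ ℂ) ∈ S.AP :=
  ⟨{1}, isCompact_singleton, fun x => ⟨1, rfl, by ext y; simp [leftTranslate]⟩⟩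

/-- `m` is a mean on `AP(K)`: a functional with `‖m‖ = 1 = m(1)`. -/
def IsMean {K : Type*} [TopologicalSpace K] [T2Space K]
    [LocallyCompactSpace K] [MeasurableSpace K] [BorelSpace K]
    (S : SemitopologicalSemihypergroup K) (m : StrongDual ℂ S.AP) : Prop :=
  ‖m‖ = 1 ∧ m ⟨1, S.one_mem_AP⟩ = 1

/-- `AP(K)` is left amenable: there is a mean `m` on `AP(K)` such that, for all `x ∈ K` and
`f ∈ AP(K)`, the translate `L_x f` lies in `AP(K)` and `m(L_x f) = m(f)`. -/
def IsLeftAmenableAP {K : Type*} [TopologicalSpace K] [T2Space K]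
    [LocallyCompactSpace K] [MeasurableSpace K] [BorelSpace K]
    (S : SemitopologicalSemihypergroup K) : Prop :=
  ∃ m : StrongDual ℂ S.AP, S.IsMean m ∧
    ∀ (x : K) (f : S.AP), ∃ g : S.AP,
      ⇑(g : K →ᵇ ℂ) = S.leftTranslate x (f : K →ᵇ ℂ) ∧ m g = m f

/-! ### Actions on a dual Banach space with the weak* topology -/

/-- `π` is an action of the semihypergroup on `(X*, weak*)`. The vector integral
`π(s, π(t, u)) = ∫ π(ζ, u) d(p_s * p_t)(ζ)` is the weak integral in the locally convex space
`(X*, weak*)`, whose continuous functionals are the evaluations at the points of `X`. -/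
structure IsDualAction {K : Type*} [TopologicalSpace K] [T2Space K]
    [LocallyCompactSpace K] [MeasurableSpace K] [BorelSpace K]
    (S : SemitopologicalSemihypergroup K) {X : Type*} [NormedAddCommGroup X] [NormedSpace ℂ X]
    (π : K → WeakDual ℂ X → WeakDual ℂ X) : Prop where
  comp : ∀ (s t : K) (u : WeakDual ℂ X) (φ : X),
    Integrable (fun ζ => π ζ u φ) (S.convMeasure s t) ∧
      π s (π t u) φ = ∫ ζ, π ζ u φ ∂(S.convMeasure s t)
  identity : ∀ e : K, S.IsTwoSidedIdentity e → ∀ u : WeakDual ℂ X, π e u = u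

end SemitopologicalSemihypergroup

/-- Separate continuity of `π : K × X* → X*` for the weak* topology on `X*`. -/
def IsSeparatelyContinuousAction {K : Type*} [TopologicalSpace K] {X : Type*}
    [NormedAddCommGroup X] [NormedSpace ℂ X] (π : K → WeakDual ℂ X → WeakDual ℂ X) : Prop :=
  (∀ s : K, Continuous (π s)) ∧ ∀ u : WeakDual ℂ X, Continuous fun s : K => π s u

/-- Each `π_s` is affine, i.e. preserves convex combinations. -/
def IsAffineAction {K : Type*} {X : Type*} [NormedAddCommGroup X] [NormedSpace ℂ X]
    (π : K → WeakDual ℂ X → WeakDual ℂ X) : Prop :=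
  ∀ (s : K) (u v : WeakDual ℂ X) (a b : ℝ), 0 ≤ a → 0 ≤ b → a + b = 1 →
    π s ((a : ℂ) • u + (b : ℂ) • v) = (a : ℂ) • π s u + (b : ℂ) • π s v

/-- Equicontinuity of `{π_s : s ∈ K}` on compact sets: for every weak* compact `C ⊆ X*`, every
`x ∈ C` and every weak* neighbourhood `U` of `0` there is a weak* neighbourhood `V` of `0` such that
`π(s, y) - π(s, x) ∈ U` for all `s ∈ K` whenever `y ∈ C` and `y - x ∈ V`. -/
def IsEquicontinuousAction {K : Type*} {X : Type*} [NormedAddCommGroup X] [NormedSpace ℂ X]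
    (π : K → WeakDual ℂ X → WeakDual ℂ X) : Prop :=
  ∀ C : Set (WeakDual ℂ X), IsCompact C → ∀ x ∈ C, ∀ U ∈ 𝓝 (0 : WeakDual ℂ X),
    ∃ V ∈ 𝓝 (0 : WeakDual ℂ X), ∀ y ∈ C, y - x ∈ V → ∀ s : K, π s y - π s x ∈ U

/-! From amenability to a fixed point. On the weak* closure of the bounded orbit, equicontinuity and
Arzelà–Ascoli make every coefficient `s ↦ π s ω₀ φ` almost periodic; a mean applied to these
coefficients defines a point of `X*`. Since the weak* dual of `X*` is `X`, the real part of a weak*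
continuous affine function is a constant plus the real part of an evaluation, so such functions
commute with the mean. For `u ↦ π a u φ` this turns invariance of the mean into fixedness of the
point.

Conversely, the adjoint of translation on `AP(K)*` always fixes `0`. The twisted action
`shiftedAdjoint` conjugates every hyperplane `u(1) = c` to `u(1) = 1`, so each of its fixed points
yields an invariant functional `m` with `m(1) = 1`. The norm of `m` is not controlled, and no
lattice structure on `AP(K)` is at hand to extract a positive part. Instead, `coeffKernel m`
collects the `f` whose coefficients `s ↦ ψ (L_s f)` are all annihilated by `m`. It is a closed
subspace containing every `L_x f - f`. If `1` has distance at least `1` from it, Hahn–Banach on the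
quotient gives an invariant mean.

For that distance, let `g` lie in the kernel with `‖1 - g‖ = r < 1`. The closed convex hull of the
translates of `g` is compact, invariant, inside the kernel and inside the ball of radius `r` about
`1`. The collapsing lemma `exists_forall_norm_map_map_sub_le` finds `h` in it and a contraction `L`
with `L (L_s h)` nearly independent of `s`. Evaluating at a point `x₀`, `m` kills a nearly constant
coefficient, so `L h x₀` is nearly `0`, although it is within `r` of `1`.

Underneath lies `L_t L_s f = ∫ L_ζ f d(p_s * p_t)(ζ)`, which is associativity tested on functions.
It uses the density of convex combinations of point masses in the probability measures. -/

namespace PositiveRegularMeasure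

/-! ### Integration and the cone topology on `M⁺(K)`. -/

variable {K : Type*} [TopologicalSpace K] [T2Space K] [MeasurableSpace K] [BorelSpace K]

instance (μ : PositiveRegularMeasure K) : IsFiniteMeasure μ.toMeasure :=
  SHG.isFiniteMeasure_variation _

instance (μ : PositiveRegularMeasure K) : μ.toMeasure.Regular := μ.val.2

theorem toMeasure_apply (μ : PositiveRegularMeasure K) {A : Set K} (hA : MeasurableSet A) :
    μ.toMeasure A = ENNReal.ofReal ((μ.val : ComplexMeasure K) A).re :=
  μ.nonneg.variation_apply hA

/-- The sum of two non-negative regular measures. -/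
noncomputable def add (μ ν : PositiveRegularMeasure K) : PositiveRegularMeasure K :=
  ⟨μ.val + ν.val, fun A hA => by
    have h1 := μ.nonneg A hA
    have h2 := ν.nonneg A hA
    simp only [Submodule.coe_add, _root_.add_apply, Complex.add_re, Complex.add_im]
    exact ⟨add_nonneg h1.1 h2.1, by rw [h1.2, h2.2, add_zero]⟩⟩

/-- A non-negative multiple of a non-negative regular measure. -/
noncomputable def smul (c : ℝ≥0) (μ : PositiveRegularMeasure K) : PositiveRegularMeasure K :=
  ⟨((c : ℝ) : ℂ) • μ.val, fun A hA => by
    have h1 := μ.nonneg A hA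
    simp only [Submodule.coe_smul, _root_.smul_apply, smul_eq_mul, Complex.re_ofReal_mul,
      Complex.im_ofReal_mul]
    exact ⟨mul_nonneg c.2 h1.1, by rw [h1.2, mul_zero]⟩⟩

/-- The point mass as a non-negative regular measure. -/
noncomputable def dirac (x : K) : PositiveRegularMeasure K :=
  ⟨pointMass x, isNonnegMeasure_pointMass x⟩

theorem toMeasure_add (μ ν : PositiveRegularMeasure K) :
    (μ.add ν).toMeasure = μ.toMeasure + ν.toMeasure := by
  ext A hA
  rw [Measure.add_apply, toMeasure_apply _ hA, toMeasure_apply _ hA, toMeasure_apply _ hA,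
    ← ENNReal.ofReal_add (μ.nonneg A hA).1 (ν.nonneg A hA).1]
  rfl

theorem toMeasure_smul (c : ℝ≥0) (μ : PositiveRegularMeasure K) :
    (μ.smul c).toMeasure = c • μ.toMeasure := by
  ext A hA
  rw [Measure.smul_apply, toMeasure_apply _ hA, toMeasure_apply _ hA]
  have : (((μ.smul c).val : ComplexMeasure K) A).re = c * ((μ.val : ComplexMeasure K) A).re := by
    simp [smul]
  rw [this, ENNReal.ofReal_mul (NNReal.coe_nonneg c), ENNReal.ofReal_coe_nnreal]
  rfl

theorem toMeasure_dirac (x : K) : (dirac x).toMeasure = Measure.dirac x := by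
  ext A hA
  rw [toMeasure_apply _ hA, Measure.dirac_apply' _ hA]
  by_cases hx : x ∈ A
  · have h : (pointMass x : ComplexMeasure K) A = 1 := VectorMeasure.dirac_apply_of_mem hA hx
    simp [dirac, h, hx]
  · have h : (pointMass x : ComplexMeasure K) A = 0 := VectorMeasure.dirac_apply_of_notMem hx
    simp [dirac, h, hx]

theorem continuous_mass :
    Continuous fun μ : PositiveRegularMeasure K => μ.toMeasure.real Set.univ :=
  continuous_snd.comp (continuous_induced_dom (f := fun μ : PositiveRegularMeasure K =>
    ((fun f : CompactlySupportedContinuousMap K ℝ≥0 => ∫ x, (f x : ℝ) ∂μ.toMeasure),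
      μ.toMeasure.real Set.univ)))

theorem integrable_nnreal (f : CompactlySupportedContinuousMap K ℝ≥0)
    (μ : PositiveRegularMeasure K) : Integrable (fun x => (f x : ℝ)) μ.toMeasure :=
  (NNReal.continuous_coe.comp f.continuous).integrable_of_hasCompactSupport
    (f.hasCompactSupport.comp_left rfl)

theorem continuous_integral_nnreal (f : CompactlySupportedContinuousMap K ℝ≥0) :
    Continuous fun μ : PositiveRegularMeasure K => ∫ x, (f x : ℝ) ∂μ.toMeasure :=
  (continuous_apply f).comp (continuous_fst.comp (continuous_induced_dom
    (f := fun μ : PositiveRegularMeasure K =>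
      ((fun f : CompactlySupportedContinuousMap K ℝ≥0 => ∫ x, (f x : ℝ) ∂μ.toMeasure),
        μ.toMeasure.real Set.univ))))

theorem continuous_dirac : Continuous (dirac : K → PositiveRegularMeasure K) := by
  rw [continuous_induced_rng]
  refine Continuous.prodMk (continuous_pi fun f => ?_) ?_
  · simp only [toMeasure_dirac, integral_dirac]
    exact NNReal.continuous_coe.comp f.continuous
  · simp only [toMeasure_dirac, probReal_univ]
    exact continuous_const

theorem continuous_integral_compactlySupported (f : CompactlySupportedContinuousMap K ℝ) :
    Continuous fun μ : PositiveRegularMeasure K => ∫ x, f x ∂μ.toMeasure := by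
  have h : ∀ μ : PositiveRegularMeasure K, ∫ x, f x ∂μ.toMeasure =
      ∫ x, (f.nnrealPart x : ℝ) ∂μ.toMeasure - ∫ x, ((-f).nnrealPart x : ℝ) ∂μ.toMeasure := by
    intro μ
    rw [← integral_sub (integrable_nnreal _ μ) (integrable_nnreal _ μ)]
    congr 1 with x
    simp [max_zero_sub_max_neg_zero_eq_self]
  simp_rw [h]
  exact (continuous_integral_nnreal _).sub (continuous_integral_nnreal _)

variable [LocallyCompactSpace K]

/-- Integration of a bounded continuous real function is continuous for the cone topology. -/
theorem continuous_integral_real (f : K →ᵇ ℝ) :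
    Continuous fun μ : PositiveRegularMeasure K => ∫ x, f x ∂μ.toMeasure := by
  rw [continuous_iff_continuousAt]
  intro μ₀
  rw [Metric.continuousAt_iff']
  intro ε hε
  have hη : 0 < ε / (3 * (‖f‖ + 1)) := by positivity
  set η := ε / (3 * (‖f‖ + 1)) with hηdef
  -- Most of the mass of `μ₀` sits on a compact `F`. With a cutoff `χ` equal to `1` on `F`,
  -- replacing `f` by `f χ` costs at most `‖f‖ (μ(K) - ∫ χ dμ)`. This bound is continuous in `μ`, so
  -- it stays small near `μ₀`.
  obtain ⟨F, -, hF, hlt⟩ := MeasurableSet.univ.exists_isCompact_sdiff_lt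
    (measure_ne_top μ₀.toMeasure _) (ENNReal.ofReal_pos.mpr hη).ne'
  obtain ⟨χ, hχ1, hχF, hχs, hχ⟩ := exists_continuousMap_one_of_isCompact_subset_isOpen hF
    isOpen_univ (Set.subset_univ F)
  let χc : CompactlySupportedContinuousMap K ℝ := ⟨χ, hχF⟩
  let g : CompactlySupportedContinuousMap K ℝ := ⟨f.toContinuousMap * χ, HasCompactSupport.mul_left hχF⟩
  have key : ∀ μ : PositiveRegularMeasure K, |∫ x, f x ∂μ.toMeasure - ∫ x, g x ∂μ.toMeasure| ≤
      ‖f‖ * (μ.toMeasure.real Set.univ - ∫ x, χc x ∂μ.toMeasure) := by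
    intro μ
    have i1 : Integrable f μ.toMeasure := f.integrable _
    have i2 : Integrable g μ.toMeasure := g.integrable
    have i3 : Integrable χc μ.toMeasure := χc.integrable
    rw [← integral_sub i1 i2]
    have h1 : μ.toMeasure.real Set.univ = ∫ _, (1 : ℝ) ∂μ.toMeasure := by simp
    rw [h1, ← integral_sub (integrable_const _) i3, ← integral_const_mul, ← Real.norm_eq_abs]
    refine norm_integral_le_of_norm_le (((integrable_const _).sub i3).const_mul _) ?_
    refine Filter.Eventually.of_forall fun x => ?_
    have h2 : f x - g x = f x * (1 - χ x) := by
      change f x - f x * χ x = _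
      ring
    have h3 := (hχ x).2
    rw [h2, norm_mul]
    have h4 : ‖1 - χ x‖ = 1 - χ x := Real.norm_of_nonneg (by linarith)
    rw [h4]
    exact mul_le_mul_of_nonneg_right (f.norm_coe_le_norm x) (by linarith)
  have hsmall : μ₀.toMeasure.real Set.univ - ∫ x, χc x ∂μ₀.toMeasure < η := by
    have h1 : μ₀.toMeasure.real F ≤ ∫ x, χc x ∂μ₀.toMeasure := by
      rw [← integral_indicator_one hF.measurableSet]
      refine integral_mono (integrable_const (1 : ℝ) |>.indicator hF.measurableSet) χc.integrable ?_
      intro x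
      by_cases hx : x ∈ F
      · simp only [Set.indicator_of_mem hx, Pi.one_apply]
        exact (hχ1 hx).ge
      · simp only [Set.indicator_of_notMem hx]
        exact (hχ x).1
    have h2 : μ₀.toMeasure.real (Set.univ \ F) < η := by
      rw [Measure.real, ← ENNReal.toReal_ofReal hη.le]
      exact (ENNReal.toReal_lt_toReal (measure_ne_top _ _) ENNReal.ofReal_ne_top).mpr hlt
    have h3 := measureReal_sdiff (μ := μ₀.toMeasure) (Set.subset_univ F) hF.measurableSet
    linarith
  have e1 := ((continuous_mass (K := K)).sub
    (continuous_integral_compactlySupported χc)).continuousAt (x := μ₀) |>.eventually_lt_const hsmall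
  have e2 := Metric.continuousAt_iff'.mp
    ((continuous_integral_compactlySupported g).continuousAt (x := μ₀)) (ε / 3) (by positivity : 0 < ε / 3)
  filter_upwards [e1, e2] with μ h1 h2
  have hb : ‖f‖ * η < ε / 3 := by
    rw [hηdef]
    have : ‖f‖ * (ε / (3 * (‖f‖ + 1))) = (ε / 3) * (‖f‖ / (‖f‖ + 1)) := by field_simp
    rw [this]
    have h5 : ‖f‖ / (‖f‖ + 1) < 1 := by
      rw [div_lt_one (by positivity)]
      linarith
    nlinarith
  have k1 := (key μ).trans (mul_le_mul_of_nonneg_left h1.le (norm_nonneg f))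
  have k2 := (key μ₀).trans (mul_le_mul_of_nonneg_left hsmall.le (norm_nonneg f))
  rw [Real.dist_eq] at h2 ⊢
  rw [abs_le] at k1 k2
  rw [abs_lt] at h2 ⊢
  constructor <;> linarith

/-- Integration of a bounded continuous function is continuous for the cone topology. -/
theorem continuous_integral (f : K →ᵇ ℂ) :
    Continuous fun μ : PositiveRegularMeasure K => ∫ x, f x ∂μ.toMeasure := by
  let fr : K →ᵇ ℝ := BoundedContinuousFunction.ofNormedAddCommGroup (fun x => (f x).re)
    (Complex.continuous_re.comp f.continuous) ‖f‖
    fun x => (Complex.abs_re_le_norm _).trans (f.norm_coe_le_norm x)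
  let fi : K →ᵇ ℝ := BoundedContinuousFunction.ofNormedAddCommGroup (fun x => (f x).im)
    (Complex.continuous_im.comp f.continuous) ‖f‖
    fun x => (Complex.abs_im_le_norm _).trans (f.norm_coe_le_norm x)
  have h : ∀ μ : PositiveRegularMeasure K, ∫ x, f x ∂μ.toMeasure =
      ((∫ x, fr x ∂μ.toMeasure : ℝ) : ℂ) + ((∫ x, fi x ∂μ.toMeasure : ℝ) : ℂ) * Complex.I := by
    intro μ
    exact (integral_re_add_im (𝕜 := ℂ) (f.integrable _)).symm
  simp_rw [h]
  exact (Complex.continuous_ofReal.comp (continuous_integral_real fr)).add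
    ((Complex.continuous_ofReal.comp (continuous_integral_real fi)).mul continuous_const)

/-- A continuous positively linear map on `M⁺(K)` that maps point masses to probability measures is
determined by its values at the point masses, in the form of an integral formula. -/
theorem integral_map_eq (Θ : PositiveRegularMeasure K → PositiveRegularMeasure K)
    (hΘ : Continuous Θ) (hadd : ∀ μ ν, Θ (μ.add ν) = (Θ μ).add (Θ ν))
    (hsmul : ∀ (c : ℝ≥0) μ, Θ (μ.smul c) = (Θ μ).smul c)
    (hmass : ∀ x, (Θ (dirac x)).toMeasure.real Set.univ = 1) (f : K →ᵇ ℂ)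
    (μ : PositiveRegularMeasure K) (hμ : IsProbabilityMeasure μ.toMeasure) :
    ∫ z, f z ∂(Θ μ).toMeasure = ∫ x, ∫ z, f z ∂(Θ (dirac x)).toMeasure ∂μ.toMeasure := by
  let F : K →ᵇ ℂ := BoundedContinuousFunction.ofNormedAddCommGroup
    (fun x => ∫ z, f z ∂(Θ (dirac x)).toMeasure)
    ((continuous_integral f).comp (hΘ.comp continuous_dirac)) ‖f‖ fun x => by
      refine (norm_integral_le_of_norm_le_const
        (Filter.Eventually.of_forall f.norm_coe_le_norm)).trans ?_
      rw [hmass, mul_one]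
  -- The identity is a closed condition, so it suffices to approximate `μ` by elements of `D`, which
  -- is convex and contains the point masses.
  let D : Set (PositiveRegularMeasure K) :=
    {ν | ν.toMeasure.real Set.univ = 1 ∧ ∫ z, f z ∂(Θ ν).toMeasure = ∫ x, F x ∂ν.toMeasure}
  suffices h : μ ∈ closure D by
    have hcl : IsClosed {ν : PositiveRegularMeasure K |
        ∫ z, f z ∂(Θ ν).toMeasure = ∫ x, F x ∂ν.toMeasure} :=
      isClosed_eq ((continuous_integral f).comp hΘ) (continuous_integral F)
    exact closure_minimal (fun ν hν => hν.2) hcl h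
  have hdirac : ∀ x, dirac x ∈ D := by
    intro x
    refine ⟨by simp [toMeasure_dirac], ?_⟩
    rw [toMeasure_dirac, integral_dirac]
    rfl
  have hconv : ∀ μ ∈ D, ∀ ν ∈ D, ∀ a b : ℝ≥0, a + b = 1 → (μ.smul a).add (ν.smul b) ∈ D := by
    rintro μ ⟨hμ1, hμ2⟩ ν ⟨hν1, hν2⟩ a b hab
    have hab' : (a : ℝ) + b = 1 := by exact_mod_cast hab
    refine ⟨?_, ?_⟩
    · rw [toMeasure_add, toMeasure_smul, toMeasure_smul, measureReal_add_apply,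
        measureReal_nnreal_smul_apply, measureReal_nnreal_smul_apply, hμ1, hν1]
      simpa using hab'
    · rw [hadd, hsmul, hsmul]
      simp only [toMeasure_add, toMeasure_smul]
      rw [integral_add_measure ((f.integrable _)) ((f.integrable _)),
        integral_add_measure ((F.integrable _)) ((F.integrable _))]
      simp only [integral_smul_nnreal_measure, hμ2, hν2]
  rw [mem_closure_iff_nhds]
  intro U hU
  rw [nhds_induced, Filter.mem_comap] at hU
  obtain ⟨V, hV, hVU⟩ := hU
  rw [nhds_prod_eq, Filter.mem_prod_iff] at hV
  obtain ⟨V₁, hV₁, V₂, hV₂, hV⟩ := hV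
  rw [nhds_pi, Filter.mem_pi] at hV₁
  obtain ⟨I, hI, t, ht, hIt⟩ := hV₁
  have := hI.fintype
  let ev : PositiveRegularMeasure K → (I → ℝ) := fun ν i => ∫ x, (i.1 x : ℝ) ∂ν.toMeasure
  have hZ : Convex ℝ (ev '' D) := by
    rintro _ ⟨μ, hμ, rfl⟩ _ ⟨ν, hν, rfl⟩ a b ha hb hab
    lift a to ℝ≥0 using ha
    lift b to ℝ≥0 using hb
    refine ⟨_, hconv μ hμ ν hν a b (NNReal.eq hab), ?_⟩
    ext i
    simp only [ev, toMeasure_add, toMeasure_smul]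
    rw [← toMeasure_smul, ← toMeasure_smul,
      integral_add_measure (integrable_nnreal _ _) (integrable_nnreal _ _)]
    simp only [toMeasure_smul, integral_smul_nnreal_measure]
    rfl
  have hint : Integrable (fun x => fun i : I => (i.1 x : ℝ)) μ.toMeasure :=
    Integrable.of_eval fun i => integrable_nnreal i.1 μ
  -- A basic neighbourhood tests finitely many functions, so the problem lives in `ℝ^I`, where the
  -- average of a vector function over a probability measure lies in the closed convex hull of its
  -- values.
  have hmem : ∫ x, (fun i : I => (i.1 x : ℝ)) ∂μ.toMeasure ∈ closure (ev '' D) := by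
    refine hZ.closure.integral_mem isClosed_closure (Filter.Eventually.of_forall fun x => ?_) hint
    refine subset_closure ⟨dirac x, hdirac x, ?_⟩
    ext i
    simp only [ev, toMeasure_dirac, integral_dirac]
  have hev : ∫ x, (fun i : I => (i.1 x : ℝ)) ∂μ.toMeasure = ev μ := by
    ext i
    exact eval_integral (fun i : I => integrable_nnreal i.1 μ) i
  rw [hev, mem_closure_iff_nhds] at hmem
  obtain ⟨_, hv, ν, hν, rfl⟩ := hmem (Set.pi Set.univ fun i : I => t i.1)
    (set_pi_mem_nhds Set.finite_univ fun i _ => ht i.1)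
  refine ⟨ν, hVU (hV ⟨hIt fun i hi => hv ⟨i, hi⟩ (Set.mem_univ _), ?_⟩), hν⟩
  have hμ1 : μ.toMeasure.real Set.univ = 1 := by simp
  have := mem_of_mem_nhds hV₂
  simp only [hμ1] at this
  simpa [hν.1] using this

end PositiveRegularMeasure

/-! ### Norm continuity and integrability of relatively compact families. -/

/-- A pointwise continuous family of bounded continuous functions that stays in a compact set is
norm continuous. -/
theorem BoundedContinuousFunction.continuous_of_forall_continuous_apply {Y Z : Type*}
    [TopologicalSpace Y] [TopologicalSpace Z] {C : Set (Z →ᵇ ℂ)} (hC : IsCompact C)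
    {F : Y → Z →ᵇ ℂ} (hFC : ∀ y, F y ∈ C) (hF : ∀ z, Continuous fun y => F y z) :
    Continuous F := by
  have : CompactSpace C := isCompact_iff_compactSpace.mp hC
  have h1 : Continuous fun g : C => (⇑(g : Z →ᵇ ℂ) : Z → ℂ) :=
    BoundedContinuousFunction.continuous_coe.comp continuous_subtype_val
  have h2 : Function.Injective fun g : C => (⇑(g : Z →ᵇ ℂ) : Z → ℂ) :=
    DFunLike.coe_injective.comp Subtype.val_injective
  have h3 := (h1.isClosedEmbedding h2).isEmbedding
  have h4 : Continuous fun y => (⟨F y, hFC y⟩ : C) :=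
    h3.continuous_iff.mpr (continuous_pi hF)
  exact continuous_subtype_val.comp h4

/-- A continuous function with totally bounded range is integrable for every finite measure. -/
theorem Continuous.integrable_of_totallyBounded_range {Y E : Type*} [TopologicalSpace Y]
    [MeasurableSpace Y] [OpensMeasurableSpace Y] [NormedAddCommGroup E] [CompleteSpace E]
    {F : Y → E} (hF : Continuous F) (hb : TotallyBounded (Set.range F)) (ν : Measure Y)
    [IsFiniteMeasure ν] : Integrable F ν := by
  have hC := hb.closure.isCompact_of_isClosed isClosed_closure
  have hFC : ∀ y, F y ∈ closure (Set.range F) := fun y => subset_closure ⟨y, rfl⟩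
  have : CompactSpace (closure (Set.range F)) := isCompact_iff_compactSpace.mp hC
  have h : Continuous fun y => (⟨F y, hFC y⟩ : closure (Set.range F)) := hF.subtype_mk hFC
  obtain ⟨R, hR⟩ := hC.isBounded.exists_norm_le
  exact Integrable.of_bound
    (continuous_subtype_val.comp_stronglyMeasurable h.stronglyMeasurable).aestronglyMeasurable R
    (Filter.Eventually.of_forall fun y => hR _ (hFC y))

/-! ### Translation operators and `AP(K)`. -/

namespace SemitopologicalSemihypergroup

open PositiveRegularMeasure

variable {K : Type*} [TopologicalSpace K] [T2Space K] [LocallyCompactSpace K]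
    [MeasurableSpace K] [BorelSpace K] (S : SemitopologicalSemihypergroup K)

/-- Convolution by `ω` on the left, as a self-map of `M⁺(K)`. -/
noncomputable def leftConv (ω μ : PositiveRegularMeasure K) : PositiveRegularMeasure K :=
  ⟨S.conv ω.val μ.val, S.conv_nonneg ω μ⟩

/-- Convolution with a fixed point mass is positively linear and continuous on `M⁺(K)`, so
`integral_map_eq` applies. Separate continuity is enough. -/
theorem integral_leftConv_dirac (x : K) (f : K →ᵇ ℂ) (μ : PositiveRegularMeasure K)
    (hμ : IsProbabilityMeasure μ.toMeasure) :
    ∫ z, f z ∂(S.leftConv (dirac x) μ).toMeasure = ∫ y, ∫ z, f z ∂S.convMeasure x y ∂μ.toMeasure := by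
  refine integral_map_eq (S.leftConv (dirac x)) (S.continuous_conv_left (dirac x)) ?_ ?_ ?_ f μ hμ
  · intro μ ν
    simp [leftConv, add]
  · intro c μ
    simp [leftConv, smul]
  · intro y
    change (S.convMeasure x y).real Set.univ = 1
    simp

theorem integral_leftConv_dirac_right (y : K) (f : K →ᵇ ℂ) (μ : PositiveRegularMeasure K)
    (hμ : IsProbabilityMeasure μ.toMeasure) :
    ∫ z, f z ∂(S.leftConv μ (dirac y)).toMeasure = ∫ x, ∫ z, f z ∂S.convMeasure x y ∂μ.toMeasure := by
  refine integral_map_eq (fun ν => S.leftConv ν (dirac y)) (S.continuous_conv_right (dirac y))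
    ?_ ?_ ?_ f μ hμ
  · intro μ ν
    simp [leftConv, add]
  · intro c μ
    simp [leftConv, smul]
  · intro x
    change (S.convMeasure x y).real Set.univ = 1
    simp

/-- The two bracketings of `p_s * p_t * p_y`, each tested against `f`. -/
theorem integral_integral_convMeasure (s t y : K) (f : K →ᵇ ℂ) :
    ∫ z, ∫ w, f w ∂S.convMeasure s z ∂S.convMeasure t y =
      ∫ ζ, ∫ w, f w ∂S.convMeasure ζ y ∂S.convMeasure s t := by
  have h1 := S.integral_leftConv_dirac s f (S.leftConv (dirac t) (dirac y))
    (inferInstanceAs (IsProbabilityMeasure (S.convMeasure t y)))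
  have h2 := S.integral_leftConv_dirac_right y f (S.leftConv (dirac s) (dirac t))
    (inferInstanceAs (IsProbabilityMeasure (S.convMeasure s t)))
  have h3 : S.leftConv (dirac s) (S.leftConv (dirac t) (dirac y)) =
      S.leftConv (S.leftConv (dirac s) (dirac t)) (dirac y) := by
    simp [leftConv, S.conv_assoc]
  rw [h3] at h1
  exact h1.symm.trans h2

theorem continuous_integral_convMeasure_right (x : K) (f : K →ᵇ ℂ) :
    Continuous fun y => ∫ z, f z ∂S.convMeasure x y :=
  (continuous_integral f).comp ((S.continuous_conv_left (dirac x)).comp continuous_dirac)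

theorem continuous_integral_convMeasure_left (y : K) (f : K →ᵇ ℂ) :
    Continuous fun x => ∫ z, f z ∂S.convMeasure x y :=
  (continuous_integral f).comp ((S.continuous_conv_right (dirac y)).comp continuous_dirac)

theorem norm_leftTranslate_le (x : K) (f : K →ᵇ ℂ) (y : K) : ‖S.leftTranslate x f y‖ ≤ ‖f‖ := by
  refine (norm_integral_le_of_norm_le_const
    (Filter.Eventually.of_forall f.norm_coe_le_norm)).trans ?_
  simp

/-- The left translation `L_x` as an operator on the bounded continuous functions. -/
noncomputable def translate (x : K) : (K →ᵇ ℂ) →L[ℂ] (K →ᵇ ℂ) :=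
  LinearMap.mkContinuous
    { toFun := fun f => BoundedContinuousFunction.ofNormedAddCommGroup (S.leftTranslate x f)
        (S.continuous_integral_convMeasure_right x f) ‖f‖ (S.norm_leftTranslate_le x f)
      map_add' := fun f g => by
        ext y
        exact integral_add (f.integrable _) (g.integrable _)
      map_smul' := fun c f => by
        ext y
        exact integral_smul c _ }
    1 fun f => by
      rw [one_mul]
      exact BoundedContinuousFunction.norm_ofNormedAddCommGroup_le _ (norm_nonneg f)
        (S.norm_leftTranslate_le x f)

theorem translate_apply (x : K) (f : K →ᵇ ℂ) (y : K) :
    S.translate x f y = ∫ z, f z ∂S.convMeasure x y := rfl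

theorem norm_translate_le (x : K) : ‖S.translate x‖ ≤ 1 :=
  LinearMap.mkContinuous_norm_le _ zero_le_one _

theorem norm_translate_apply_le (x : K) (f : K →ᵇ ℂ) : ‖S.translate x f‖ ≤ ‖f‖ :=
  (S.translate x).le_of_opNorm_le (S.norm_translate_le x) f |>.trans_eq (one_mul _)

theorem translate_one (x : K) : S.translate x 1 = 1 := by
  ext y
  simp [translate_apply]

theorem translate_translate_apply (s t : K) (f : K →ᵇ ℂ) (y : K) :
    S.translate t (S.translate s f) y = ∫ ζ, S.translate ζ f y ∂S.convMeasure s t :=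
  S.integral_integral_convMeasure s t y f

theorem translate_of_isTwoSidedIdentity {e : K} (he : S.IsTwoSidedIdentity e) (f : K →ᵇ ℂ) :
    S.translate e f = f := by
  ext y
  have h : S.convMeasure e y = Measure.dirac y := by
    rw [← toMeasure_dirac]
    simp [convMeasure, dirac, (he y).2]
  rw [translate_apply, h, integral_dirac]

theorem continuous_translate_apply (f : K →ᵇ ℂ) (y : K) :
    Continuous fun x => S.translate x f y :=
  S.continuous_integral_convMeasure_left y f

theorem mem_AP_iff {f : K →ᵇ ℂ} :
    f ∈ S.AP ↔ TotallyBounded (Set.range fun x => S.translate x f) := by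
  constructor
  · rintro ⟨C, hC, h⟩
    refine hC.totallyBounded.subset ?_
    rintro _ ⟨x, rfl⟩
    obtain ⟨g, hg, hgx⟩ := h x
    have : S.translate x f = g := DFunLike.coe_injective hgx.symm
    change S.translate x f ∈ C
    rwa [this]
  · intro h
    exact ⟨_, h.closure.isCompact_of_isClosed isClosed_closure,
      fun x => ⟨S.translate x f, subset_closure ⟨x, rfl⟩, rfl⟩⟩

/-- Translations are contractions, so a finite net for the orbit of a nearby `g` serves the orbit of
`f`. Closedness makes `AP(K)` a Banach space, as needed for it to play the role of `X`. -/
theorem isClosed_AP : IsClosed (S.AP : Set (K →ᵇ ℂ)) := by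
  refine isClosed_of_closure_subset fun f hf => ?_
  rw [SetLike.mem_coe, mem_AP_iff, Metric.totallyBounded_iff]
  intro ε hε
  obtain ⟨g, hg, hfg⟩ := Metric.mem_closure_iff.mp hf (ε / 2) (half_pos hε)
  obtain ⟨t, ht, hgt⟩ := Metric.totallyBounded_iff.mp (S.mem_AP_iff.mp hg) (ε / 2) (half_pos hε)
  refine ⟨t, ht, ?_⟩
  rintro _ ⟨x, rfl⟩
  obtain ⟨h, hh, hd⟩ := Set.mem_iUnion₂.mp (hgt ⟨x, rfl⟩)
  refine Set.mem_iUnion₂.mpr ⟨h, hh, ?_⟩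
  rw [Metric.mem_ball] at hd ⊢
  have h1 : dist (S.translate x f) (S.translate x g) < ε / 2 := by
    rw [dist_eq_norm, ← map_sub]
    exact (S.norm_translate_apply_le x _).trans_lt (by rwa [← dist_eq_norm])
  calc _ ≤ _ := dist_triangle _ (S.translate x g) _
    _ < ε / 2 + ε / 2 := add_lt_add h1 hd
    _ = ε := add_halves ε

instance : CompleteSpace S.AP := S.isClosed_AP.completeSpace_coe

variable {S}

theorem isCompact_closure_range_translate {f : K →ᵇ ℂ} (hf : f ∈ S.AP) :
    IsCompact (closure (Set.range fun x => S.translate x f)) :=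
  (S.mem_AP_iff.mp hf).closure.isCompact_of_isClosed isClosed_closure

/-- The semihypergroup axioms give pointwise continuity only; relative compactness of the orbit
upgrades it to norm continuity, which makes Bochner integrals of translates available. -/
theorem continuous_translate {f : K →ᵇ ℂ} (hf : f ∈ S.AP) :
    Continuous fun x => S.translate x f :=
  BoundedContinuousFunction.continuous_of_forall_continuous_apply
    (isCompact_closure_range_translate hf) (fun x => subset_closure ⟨x, rfl⟩)
    (S.continuous_translate_apply f)

theorem integrable_translate {f : K →ᵇ ℂ} (hf : f ∈ S.AP) (ν : Measure K) [IsFiniteMeasure ν] :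
    Integrable (fun x => S.translate x f) ν :=
  (continuous_translate hf).integrable_of_totallyBounded_range (S.mem_AP_iff.mp hf) ν

/-- The composition of two translations is an average of translations. -/
theorem translate_translate {f : K →ᵇ ℂ} (hf : f ∈ S.AP) (s t : K) :
    S.translate t (S.translate s f) = ∫ ζ, S.translate ζ f ∂S.convMeasure s t := by
  ext y
  rw [S.translate_translate_apply]
  exact (BoundedContinuousFunction.evalCLM ℂ y).integral_comp_comm (integrable_translate hf (S.convMeasure s t))

theorem translate_translate_mem_closedConvexHull {f : K →ᵇ ℂ} (hf : f ∈ S.AP) (s t : K) :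
    S.translate t (S.translate s f) ∈ closedConvexHull ℝ (Set.range fun x => S.translate x f) := by
  rw [translate_translate hf]
  exact convex_closedConvexHull.integral_mem isClosed_closedConvexHull
    (Filter.Eventually.of_forall fun x => subset_closedConvexHull ⟨x, rfl⟩)
    (integrable_translate hf _)

theorem isCompact_closedConvexHull_range_translate {f : K →ᵇ ℂ} (hf : f ∈ S.AP) :
    IsCompact (closedConvexHull ℝ (Set.range fun x => S.translate x f)) := by
  rw [closedConvexHull_eq_closure_convexHull]
  exact (S.mem_AP_iff.mp hf).convexHull.closure.isCompact_of_isClosed isClosed_closure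

/-- A composite of two translations is an average of translations, so the orbit of `L_s f` stays in
the closed convex hull of the orbit of `f`, which is compact. -/
theorem translate_mem_AP {f : K →ᵇ ℂ} (hf : f ∈ S.AP) (s : K) : S.translate s f ∈ S.AP :=
  ⟨_, isCompact_closedConvexHull_range_translate hf,
    fun t => ⟨_, translate_translate_mem_closedConvexHull hf s t, rfl⟩⟩

end SemitopologicalSemihypergroup

/-! ### Monoids of contractions on compact sets. -/

/-- A compact set that is invariant under a family of maps contains a minimal nonempty closed
invariant set. -/
theorem IsCompact.exists_minimal_isClosed_mapsTo {E : Type*} [TopologicalSpace E] [T2Space E]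
    {C : Set E} (hC : IsCompact C) (hne : C.Nonempty) (T : Set (E → E))
    (hT : ∀ L ∈ T, Set.MapsTo L C C) :
    ∃ D ⊆ C, IsClosed D ∧ D.Nonempty ∧ (∀ L ∈ T, Set.MapsTo L D D) ∧
      ∀ D' ⊆ D, IsClosed D' → D'.Nonempty → (∀ L ∈ T, Set.MapsTo L D' D') → D' = D := by
  obtain ⟨D, hDC, hD⟩ := zorn_superset_nonempty
    {D : Set E | D ⊆ C ∧ IsClosed D ∧ D.Nonempty ∧ ∀ L ∈ T, Set.MapsTo L D D} (by
      intro c hc hchain hcne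
      refine ⟨⋂₀ c, ⟨?_, ?_, ?_, ?_⟩, fun s hs => Set.sInter_subset_of_mem hs⟩
      · obtain ⟨s, hs⟩ := hcne
        exact (Set.sInter_subset_of_mem hs).trans (hc hs).1
      · exact isClosed_sInter fun s hs => (hc hs).2.1
      · have := hcne.to_subtype
        refine IsCompact.nonempty_sInter_of_directed_nonempty_isCompact_isClosed
          (fun s hs t ht => (hchain.total hs ht).elim (fun h => ⟨s, hs, subset_rfl, h⟩)
            fun h => ⟨t, ht, h, subset_rfl⟩) (fun s hs => (hc hs).2.2.1)
          (fun s hs => hC.of_isClosed_subset (hc hs).2.1 (hc hs).1) fun s hs => (hc hs).2.1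
      · intro L hL x hx s hs
        exact (hc hs).2.2.2 L hL (hx s hs)) C ⟨subset_rfl, hC.isClosed, hne, hT⟩
  refine ⟨D, hDC, hD.prop.2.1, hD.prop.2.2.1, hD.prop.2.2.2, ?_⟩
  intro D' hD' h1 h2 h3
  exact hD'.antisymm (hD.le_of_le ⟨hD'.trans hDC, h1, h2, h3⟩ hD')

/-- If finitely many points of a `T`-invariant set can be dealt with one at a time, they can be
dealt with simultaneously. -/
theorem Finset.exists_forall_norm_map_sub_le {E : Type*} [NormedAddCommGroup E] [NormedSpace ℝ E]
    {T : Set (E →L[ℝ] E)} (hone : ContinuousLinearMap.id ℝ E ∈ T)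
    (hcomp : ∀ L ∈ T, ∀ M ∈ T, L.comp M ∈ T) (hnorm : ∀ L ∈ T, ∀ f, ‖L f‖ ≤ ‖f‖) {D : Set E}
    (hinv : ∀ L ∈ T, Set.MapsTo L D D) {c : ℝ}
    (hc : ∀ x ∈ D, ∃ L ∈ T, ∀ y ∈ D, ‖L x - L y‖ ≤ c) (s : Finset E) (hs : ↑s ⊆ D) :
    ∃ L ∈ T, ∀ x ∈ s, ∀ y ∈ D, ‖L x - L y‖ ≤ c := by
  classical
  induction s using Finset.induction_on with
  | empty => exact ⟨_, hone, by simp⟩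
  | insert a s _ ih =>
    rw [Finset.coe_insert, Set.insert_subset_iff] at hs
    obtain ⟨L, hL, hLs⟩ := ih hs.2
    -- The new operator is applied after `L`: it handles the point `L a` and, being a contraction,
    -- keeps the estimates already won.
    obtain ⟨M, hM, hMa⟩ := hc (L a) (hinv L hL hs.1)
    refine ⟨M.comp L, hcomp M hM L hL, fun x hx y hy => ?_⟩
    rcases Finset.mem_insert.mp hx with rfl | hx
    · exact hMa _ (hinv L hL hy)
    · have := (hnorm M hM (L x - L y)).trans (hLs x hx y hy)
      rwa [map_sub] at this

/-- The barycentre of a finite net of a set of diameter `c` is closer than `c` to all its points. -/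
theorem Finset.norm_sum_inv_card_smul_sub_le {E : Type*} [NormedAddCommGroup E] [NormedSpace ℝ E]
    (s : Finset E) (L : E →L[ℝ] E) {c r : ℝ} {y : E} (h : ∀ x ∈ s, ‖L x - L y‖ ≤ c)
    {a : E} (ha : a ∈ s) (har : ‖L a - L y‖ ≤ r) :
    ‖L (∑ x ∈ s, (s.card : ℝ)⁻¹ • x) - L y‖ ≤ c - (c - r) / s.card := by
  classical
  have hn : (0 : ℝ) < s.card := by exact_mod_cast Finset.card_pos.mpr ⟨a, ha⟩
  have h1 : L (∑ x ∈ s, (s.card : ℝ)⁻¹ • x) - L y = (s.card : ℝ)⁻¹ • ∑ x ∈ s, (L x - L y) := by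
    rw [map_sum, Finset.smul_sum]
    simp only [smul_sub, map_smul, Finset.sum_sub_distrib]
    rw [Finset.sum_const, ← Nat.cast_smul_eq_nsmul ℝ, smul_smul, mul_inv_cancel₀ hn.ne', one_smul]
  have h2 : ‖∑ x ∈ s, (L x - L y)‖ ≤ r + (s.card - 1) * c := by
    refine (norm_sum_le _ _).trans ?_
    rw [← Finset.add_sum_erase s _ ha]
    refine add_le_add har ?_
    refine (Finset.sum_le_card_nsmul _ _ c fun x hx => h x (Finset.mem_of_mem_erase hx)).trans ?_
    rw [Finset.card_erase_of_mem ha, nsmul_eq_mul, Nat.cast_sub (Finset.card_pos.mpr ⟨a, ha⟩)]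
    simp
  rw [h1, norm_smul, norm_inv, Real.norm_of_nonneg hn.le]
  calc _ ≤ (s.card : ℝ)⁻¹ * (r + (s.card - 1) * c) := by gcongr
    _ = _ := by field_simp; ring

/-- **Collapsing.** A convex monoid `T` of linear contractions that acts on a nonempty compact set
nearly collapses some orbit to a point. -/
theorem exists_forall_norm_map_map_sub_le {E : Type*} [NormedAddCommGroup E] [NormedSpace ℝ E]
    {T : Set (E →L[ℝ] E)} (hone : ContinuousLinearMap.id ℝ E ∈ T) (hconv : Convex ℝ T)
    (hcomp : ∀ L ∈ T, ∀ M ∈ T, L.comp M ∈ T) (hnorm : ∀ L ∈ T, ∀ f, ‖L f‖ ≤ ‖f‖) {C : Set E}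
    (hC : IsCompact C) (hne : C.Nonempty) (hT : ∀ L ∈ T, Set.MapsTo L C C) {ε : ℝ} (hε : 0 < ε) :
    ∃ h ∈ C, ∃ L ∈ T, ∀ M ∈ T, ‖L (M h) - L h‖ ≤ ε := by
  obtain ⟨D, hDC, hDcl, ⟨h₀, hh₀⟩, hDinv', hDmin⟩ :=
    hC.exists_minimal_isClosed_mapsTo hne ((fun L : E →L[ℝ] E => (L : E → E)) '' T) (by
      rintro _ ⟨L, hL, rfl⟩
      exact hT L hL)
  have hDinv : ∀ L ∈ T, Set.MapsTo L D D := fun L hL => hDinv' _ ⟨L, hL, rfl⟩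
  have hDcpt : IsCompact D := hC.of_isClosed_subset hDcl hDC
  -- Orbit closures are closed and invariant, so minimality makes every orbit dense in `D`;
  -- convexity of `T` then makes `D` convex.
  have horbit : ∀ h ∈ D, closure ((fun L : E →L[ℝ] E => L h) '' T) = D := by
    intro h hh
    refine hDmin _ (closure_minimal ?_ hDcl) isClosed_closure
      ⟨h, subset_closure ⟨_, hone, rfl⟩⟩ ?_
    · rintro _ ⟨L, hL, rfl⟩
      exact hDinv L hL hh
    · rintro _ ⟨M, hM, rfl⟩
      refine Set.MapsTo.closure ?_ M.continuous
      rintro _ ⟨L, hL, rfl⟩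
      exact ⟨M.comp L, hcomp M hM L hL, rfl⟩
  have hDconv : Convex ℝ D := by
    rw [← horbit h₀ hh₀]
    refine Convex.closure ?_
    exact hconv.is_linear_image (f := fun L : E →L[ℝ] E => L h₀) ⟨fun _ _ => rfl, fun _ _ => rfl⟩
  -- Upper bounds for the diameters of the images `L D`; their infimum `δ` is shown to vanish.
  let Q : Set ℝ := {c | 0 ≤ c ∧ ∃ L ∈ T, ∀ x ∈ D, ∀ y ∈ D, ‖L x - L y‖ ≤ c}
  have hQne : Q.Nonempty := by
    obtain ⟨R, hR⟩ := hDcpt.isBounded.exists_norm_le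
    refine ⟨R + R, ?_, _, hone, fun x hx y hy => (norm_sub_le _ _).trans
      (add_le_add (hR x hx) (hR y hy))⟩
    have := (norm_nonneg h₀).trans (hR h₀ hh₀)
    positivity
  have hQbdd : BddBelow Q := ⟨0, fun c hc => hc.1⟩
  have hδ0 : 0 ≤ sInf Q := le_csInf hQne fun c hc => hc.1
  have hzero : sInf Q ≤ 0 := by
    by_contra! hδ
    set δ := sInf Q with hδdef
    obtain ⟨t, htD, htfin, htcov⟩ := hDcpt.finite_cover_balls (show 0 < δ / 4 by positivity)
    lift t to Finset E using htfin
    have htne : 0 < t.card := by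
      obtain ⟨a, ha, -⟩ := Set.mem_iUnion₂.mp (htcov hh₀)
      exact Finset.card_pos.mpr ⟨a, ha⟩
    have hn : (0 : ℝ) < t.card := by exact_mod_cast htne
    -- Averaging over the net gains `(c - δ / 4) / t.card ≥ 3 * η`: one `η` pays for the excess of
    -- `c` over `δ`, one for approximating the barycentre, and one is left.
    set η := δ / (4 * t.card) with hη
    have hη0 : 0 < η := by positivity
    have hηn : η * t.card = δ / 4 := by rw [hη]; field_simp
    obtain ⟨c, ⟨hc0, L, hL, hLc⟩, hcδ⟩ := exists_lt_of_csInf_lt hQne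
      (show sInf Q < δ + η by linarith)
    have hδc : δ ≤ c := csInf_le hQbdd ⟨hc0, L, hL, hLc⟩
    have huD : ∑ x ∈ t, (t.card : ℝ)⁻¹ • x ∈ D :=
      hDconv.sum_mem (fun _ _ => by positivity) (by simp [hn.ne']) fun x hx => htD hx
    -- Density of the orbit of `x` gives `M` moving `x` to within `η` of the barycentre of the net.
    -- Each `M y` is `δ / 4`-close to a net point, so the averaging estimate applies under `L`.
    have hclose : ∀ x ∈ D, ∃ L ∈ T, ∀ y ∈ D, ‖L x - L y‖ ≤ δ - η := by
      intro x hx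
      rw [← horbit x hx] at huD
      obtain ⟨_, ⟨M, hM, rfl⟩, hMu⟩ := Metric.mem_closure_iff.mp huD η hη0
      refine ⟨L.comp M, hcomp L hL M hM, fun y hy => ?_⟩
      obtain ⟨a, ha, hya⟩ := Set.mem_iUnion₂.mp (htcov (hDinv M hM hy))
      have h1 : ‖L a - L (M y)‖ ≤ δ / 4 := by
        rw [← map_sub]
        refine (hnorm L hL _).trans ?_
        rw [Metric.mem_ball, dist_comm, dist_eq_norm] at hya
        exact hya.le
      have h2 := t.norm_sum_inv_card_smul_sub_le L
        (fun z hz => hLc z (htD hz) _ (hDinv M hM hy)) ha h1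
      have h3 : ‖L (M x) - L (∑ x ∈ t, (t.card : ℝ)⁻¹ • x)‖ ≤ η := by
        rw [← map_sub]
        refine (hnorm L hL _).trans ?_
        rw [dist_comm, dist_eq_norm] at hMu
        exact hMu.le
      have h4 : 3 * η ≤ (c - δ / 4) / t.card := by
        rw [le_div_iff₀ hn]
        linarith
      have h5 := norm_sub_le_norm_sub_add_norm_sub (L (M x)) (L (∑ x ∈ t, (t.card : ℝ)⁻¹ • x))
        (L (M y))
      change ‖L (M x) - L (M y)‖ ≤ _
      linarith
    -- One operator serves a whole `η / 2`-net, so it shrinks `D` to diameter at most `δ - η / 2`,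
    -- below the infimum.
    obtain ⟨s, hsD, hsfin, hscov⟩ := hDcpt.finite_cover_balls (half_pos hη0)
    lift s to Finset E using hsfin
    obtain ⟨N, hN, hNs⟩ := s.exists_forall_norm_map_sub_le hone hcomp hnorm hDinv hclose hsD
    have hfin : δ - η / 2 ∈ Q := by
      refine ⟨?_, N, hN, fun x hx y hy => ?_⟩
      · have : η ≤ δ / 4 := by
          rw [← hηn]
          exact le_mul_of_one_le_right hη0.le (by exact_mod_cast htne)
        linarith
      · obtain ⟨a, ha, hxa⟩ := Set.mem_iUnion₂.mp (hscov hx)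
        have h1 : ‖N x - N a‖ ≤ η / 2 := by
          rw [← map_sub]
          refine (hnorm N hN _).trans ?_
          rw [Metric.mem_ball, dist_eq_norm] at hxa
          exact hxa.le
        have h2 := norm_sub_le_norm_sub_add_norm_sub (N x) (N a) (N y)
        have h3 := hNs a ha y hy
        linarith
    have := csInf_le hQbdd hfin
    linarith
  obtain ⟨c, ⟨-, L, hL, hLc⟩, hcε⟩ := exists_lt_of_csInf_lt hQne (hzero.trans_lt hε)
  exact ⟨h₀, hDC hh₀, L, hL, fun M hM => (hLc _ (hDinv M hM hh₀) _ hh₀).trans hcε.le⟩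

theorem Set.MapsTo.closedConvexHull_of_isLinearMap {E : Type*} [NormedAddCommGroup E]
    [NormedSpace ℝ E] {L : E → E} (hL : IsLinearMap ℝ L) (hLc : Continuous L) {s : Set E}
    (hs : Set.MapsTo L s (closedConvexHull ℝ s)) :
    Set.MapsTo L (closedConvexHull ℝ s) (closedConvexHull ℝ s) :=
  closedConvexHull_min (t := L ⁻¹' closedConvexHull ℝ s) hs
    (convex_closedConvexHull.is_linear_preimage hL) (isClosed_closedConvexHull.preimage hLc)

/-! ### From a normalized invariant functional to an invariant mean. -/

namespace SemitopologicalSemihypergroup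

variable {K : Type*} [TopologicalSpace K] [T2Space K] [LocallyCompactSpace K]
    [MeasurableSpace K] [BorelSpace K] (S : SemitopologicalSemihypergroup K)

/-- The left translation `L_x` as a map of `AP(K)` into itself. -/
noncomputable def translateAP (x : K) (f : S.AP) : S.AP :=
  ⟨S.translate x f, translate_mem_AP f.2 x⟩

/-- An invariant functional on `AP(K)` that is normalized at `1`; no positivity is required. -/
structure IsInvariantFunctional (m : StrongDual ℂ S.AP) : Prop where
  map_one : m ⟨1, S.one_mem_AP⟩ = 1
  map_translate : ∀ (x : K) (f : S.AP), m (S.translateAP x f) = m f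

/-- The function `s ↦ ψ (L_s f)`. -/
noncomputable def coeff (ψ : (K →ᵇ ℂ) →L[ℝ] ℂ) : S.AP →L[ℝ] (K →ᵇ ℂ) :=
  LinearMap.mkContinuous
    { toFun := fun f => BoundedContinuousFunction.ofNormedAddCommGroup
        (fun s => ψ (S.translate s f)) (ψ.continuous.comp (continuous_translate f.2)) (‖ψ‖ * ‖f‖)
        fun s => (ψ.le_opNorm _).trans
          (mul_le_mul_of_nonneg_left (S.norm_translate_apply_le s f) (norm_nonneg _))
      map_add' := fun f g => by
        ext s
        change ψ (S.translate s (f + g : K →ᵇ ℂ)) = ψ (S.translate s f) + ψ (S.translate s g)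
        rw [map_add, map_add]
      map_smul' := fun c f => by
        ext s
        change ψ (S.translate s (c • (f : K →ᵇ ℂ))) = c • ψ (S.translate s f)
        rw [← map_smul, ← (S.translate s).map_smul_of_tower c] }
    ‖ψ‖ fun f => BoundedContinuousFunction.norm_ofNormedAddCommGroup_le _ (by positivity)
      fun s => (ψ.le_opNorm _).trans
        (mul_le_mul_of_nonneg_left (S.norm_translate_apply_le s f) (norm_nonneg _))

theorem coeff_apply (ψ : (K →ᵇ ℂ) →L[ℝ] ℂ) (f : S.AP) (s : K) :
    S.coeff ψ f s = ψ (S.translate s f) := rfl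

/-- Both sides average `ψ (L_ζ f)` over `p_x * p_s`. Hence forming coefficients intertwines
translations, and invariance of `m` can be applied to coefficients. -/
theorem translate_coeff (ψ : (K →ᵇ ℂ) →L[ℝ] ℂ) (f : S.AP) (x : K) :
    S.translate x (S.coeff ψ f) = S.coeff ψ (S.translateAP x f) := by
  ext s
  have h := translate_translate f.2 x s
  change ∫ ζ, ψ (S.translate ζ f) ∂S.convMeasure x s = ψ (S.translate s (S.translate x f))
  rw [ψ.integral_comp_comm (integrable_translate f.2 _), S.translate_translate f.2]

theorem coeff_mem_AP (ψ : (K →ᵇ ℂ) →L[ℝ] ℂ) (f : S.AP) : S.coeff ψ f ∈ S.AP := by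
  rw [mem_AP_iff]
  have h1 : TotallyBounded (Set.range fun x => S.translateAP x f) := by
    rw [← totallyBounded_image_iff (isUniformInducing_val _), ← Set.range_comp]
    exact S.mem_AP_iff.mp f.2
  have h2 := h1.image (S.coeff ψ).uniformContinuous
  rw [← Set.range_comp] at h2
  convert h2 using 3 with x
  exact S.translate_coeff ψ f x

variable {S}

/-- The almost periodic functions whose coefficient functions are all annihilated by `m`. -/
noncomputable def coeffKernel (m : StrongDual ℂ S.AP) : Submodule ℂ S.AP where
  carrier := {f | ∀ ψ : (K →ᵇ ℂ) →L[ℝ] ℂ, m ⟨S.coeff ψ f, S.coeff_mem_AP ψ f⟩ = 0}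
  zero_mem' := fun ψ => by
    simp only [map_zero]
    exact map_zero m
  add_mem' := by
    intro f g hf hg ψ
    have h : (⟨S.coeff ψ (f + g), S.coeff_mem_AP ψ (f + g)⟩ : S.AP) =
        ⟨S.coeff ψ f, S.coeff_mem_AP ψ f⟩ + ⟨S.coeff ψ g, S.coeff_mem_AP ψ g⟩ :=
      Subtype.ext (map_add _ _ _)
    rw [h, map_add, hf ψ, hg ψ, add_zero]
  smul_mem' := by
    intro c f hf ψ
    -- The complex scalar is absorbed into `ψ`, which need only be real-linear, as the collapsing
    -- operators are.
    have h : (⟨S.coeff ψ (c • f), S.coeff_mem_AP ψ (c • f)⟩ : S.AP) =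
        ⟨S.coeff (ψ.comp (c • ContinuousLinearMap.id ℝ (K →ᵇ ℂ))) f, S.coeff_mem_AP _ f⟩ := by
      refine Subtype.ext ?_
      ext s
      change ψ (S.translate s (c • (f : K →ᵇ ℂ))) = ψ (c • S.translate s f)
      rw [map_smul]
    rw [h]
    exact hf _

theorem mem_coeffKernel {m : StrongDual ℂ S.AP} {f : S.AP} : f ∈ coeffKernel m ↔
    ∀ ψ : (K →ᵇ ℂ) →L[ℝ] ℂ, m ⟨S.coeff ψ f, S.coeff_mem_AP ψ f⟩ = 0 := Iff.rfl

theorem isClosed_coeffKernel (m : StrongDual ℂ S.AP) : IsClosed (coeffKernel m : Set S.AP) := by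
  have : (coeffKernel m : Set S.AP) = ⋂ ψ : (K →ᵇ ℂ) →L[ℝ] ℂ,
      {f | m ⟨S.coeff ψ f, S.coeff_mem_AP ψ f⟩ = 0} := by
    ext f
    simp [mem_coeffKernel]
  rw [this]
  exact isClosed_iInter fun ψ => isClosed_eq
    (m.continuous.comp ((S.coeff ψ).continuous.subtype_mk _)) continuous_const

theorem IsInvariantFunctional.map_coeff_translate {m : StrongDual ℂ S.AP}
    (hm : S.IsInvariantFunctional m) (ψ : (K →ᵇ ℂ) →L[ℝ] ℂ) (x : K) (f : S.AP) :
    m ⟨S.coeff ψ (S.translateAP x f), S.coeff_mem_AP ψ _⟩ =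
      m ⟨S.coeff ψ f, S.coeff_mem_AP ψ f⟩ := by
  rw [← hm.map_translate x ⟨S.coeff ψ f, S.coeff_mem_AP ψ f⟩]
  congr 1
  exact Subtype.ext (S.translate_coeff ψ f x).symm

theorem IsInvariantFunctional.sub_translate_mem_coeffKernel {m : StrongDual ℂ S.AP}
    (hm : S.IsInvariantFunctional m) (x : K) (f : S.AP) :
    S.translateAP x f - f ∈ coeffKernel m := by
  intro ψ
  have h : (⟨S.coeff ψ (S.translateAP x f - f), S.coeff_mem_AP ψ _⟩ : S.AP) =
      ⟨S.coeff ψ (S.translateAP x f), S.coeff_mem_AP ψ _⟩ - ⟨S.coeff ψ f, S.coeff_mem_AP ψ f⟩ :=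
    Subtype.ext (map_sub _ _ _)
  rw [h, map_sub, hm.map_coeff_translate, sub_self]

/-- The linear contractions under which every translation invariant closed convex set is
invariant. -/
def invariantContractions (S : SemitopologicalSemihypergroup K) :
    Set ((K →ᵇ ℂ) →L[ℝ] (K →ᵇ ℂ)) :=
  {L | (∀ f, ‖L f‖ ≤ ‖f‖) ∧ ∀ C : Set (K →ᵇ ℂ), IsClosed C → Convex ℝ C →
    (∀ x, Set.MapsTo (S.translate x) C C) → Set.MapsTo L C C}

theorem convex_invariantContractions : Convex ℝ S.invariantContractions := by
  rintro L ⟨hL1, hL2⟩ M ⟨hM1, hM2⟩ a b ha hb hab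
  refine ⟨fun f => ?_, fun C hC hCc hCt f hf => hCc (hL2 C hC hCc hCt hf) (hM2 C hC hCc hCt hf)
    ha hb hab⟩
  change ‖a • L f + b • M f‖ ≤ ‖f‖
  refine (norm_add_le _ _).trans ?_
  rw [norm_smul, norm_smul, Real.norm_of_nonneg ha, Real.norm_of_nonneg hb]
  calc _ ≤ a * ‖f‖ + b * ‖f‖ := by gcongr <;> [exact hL1 f; exact hM1 f]
    _ = ‖f‖ := by rw [← add_mul, hab, one_mul]

theorem translate_mapsTo_closedConvexHull {f : K →ᵇ ℂ} (hf : f ∈ S.AP) (t : K) :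
    Set.MapsTo (S.translate t) (closedConvexHull ℝ (Set.range fun x => S.translate x f))
      (closedConvexHull ℝ (Set.range fun x => S.translate x f)) := by
  refine Set.MapsTo.closedConvexHull_of_isLinearMap
    ⟨map_add (S.translate t), (S.translate t).map_smul_of_tower⟩ (S.translate t).continuous ?_
  rintro _ ⟨s, rfl⟩
  exact translate_translate_mem_closedConvexHull hf s t

/-- This distance estimate is the substitute for positivity of `m`. -/
theorem IsInvariantFunctional.one_le_norm_one_sub [Nonempty K] {m : StrongDual ℂ S.AP}
    (hm : S.IsInvariantFunctional m) {g : S.AP} (hg : g ∈ coeffKernel m) :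
    1 ≤ ‖(1 : K →ᵇ ℂ) - g‖ := by
  by_contra! hlt
  set r := ‖(1 : K →ᵇ ℂ) - g‖ with hr
  set C := closedConvexHull ℝ (Set.range fun x => S.translate x g) with hCdef
  have hCcpt : IsCompact C := isCompact_closedConvexHull_range_translate g.2
  have hCt : ∀ x, Set.MapsTo (S.translate x) C C := translate_mapsTo_closedConvexHull g.2
  obtain ⟨x₀⟩ := ‹Nonempty K›
  have hCne : C.Nonempty := ⟨_, subset_closedConvexHull ⟨x₀, rfl⟩⟩
  have hCker : C ⊆ Subtype.val '' (coeffKernel m : Set S.AP) := by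
    refine closedConvexHull_min ?_ ?_
      (S.isClosed_AP.isClosedEmbedding_subtypeVal.isClosedMap _ (isClosed_coeffKernel m))
    · rintro _ ⟨x, rfl⟩
      exact ⟨S.translateAP x g, fun ψ => (hm.map_coeff_translate ψ x g).trans (hg ψ), rfl⟩
    · exact ((coeffKernel m).restrictScalars ℝ).convex.linear_image
        (S.AP.subtype.restrictScalars ℝ)
  have hCball : C ⊆ Metric.closedBall 1 r := by
    refine closedConvexHull_min ?_ (convex_closedBall _ _) Metric.isClosed_closedBall
    rintro _ ⟨x, rfl⟩
    rw [Metric.mem_closedBall, dist_comm, dist_eq_norm]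
    have := S.norm_translate_apply_le x (1 - g)
    rwa [map_sub, translate_one] at this
  -- Multiplied by `‖m‖`, this tolerance is at most `(1 - r) / 2`, and `r + (1 - r) / 2 < 1`.
  have hε : 0 < (1 - r) / (2 * (‖m‖ + 1)) := by
    have : 0 < 1 - r := by linarith
    positivity
  -- Translations need not be closed under composition, so collapsing uses the convex monoid
  -- `invariantContractions`, which contains them and still preserves `C`.
  obtain ⟨h, hhC, L, hL, hLh⟩ := exists_forall_norm_map_map_sub_le (T := S.invariantContractions)
    ⟨fun _ => le_rfl, fun C _ _ _ => Set.mapsTo_id C⟩ convex_invariantContractions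
    (fun L hL M hM => ⟨fun f => (hL.1 _).trans (hM.1 f),
      fun C h1 h2 h3 => (hL.2 C h1 h2 h3).comp (hM.2 C h1 h2 h3)⟩)
    (fun L hL => hL.1) hCcpt hCne
    (fun L hL => hL.2 C isClosed_closedConvexHull convex_closedConvexHull hCt) hε
  have hLhC : L h ∈ C := hL.2 C isClosed_closedConvexHull convex_closedConvexHull hCt hhC
  obtain ⟨h, hhker, rfl⟩ := hCker hhC
  have h1 : ‖(1 : ℂ) - L h x₀‖ ≤ r := by
    have := hCball hLhC
    rw [Metric.mem_closedBall, dist_comm, dist_eq_norm] at this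
    exact (((1 : K →ᵇ ℂ) - L h).norm_coe_le_norm x₀).trans this
  -- The coefficient of `h` along this `ψ` is nearly the constant `L h x₀`, while `m` annihilates it
  -- because `h` is in the kernel.
  let ψ : (K →ᵇ ℂ) →L[ℝ] ℂ := (BoundedContinuousFunction.evalCLM ℝ x₀).comp L
  have h2 : ‖(⟨S.coeff ψ h, S.coeff_mem_AP ψ h⟩ : S.AP) - L h x₀ • ⟨1, S.one_mem_AP⟩‖ ≤
      (1 - r) / (2 * (‖m‖ + 1)) := by
    change ‖S.coeff ψ h - L h x₀ • (1 : K →ᵇ ℂ)‖ ≤ _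
    rw [BoundedContinuousFunction.norm_le hε.le]
    intro s
    have h3 := hLh ((S.translate s).restrictScalars ℝ)
      ⟨S.norm_translate_apply_le s, fun C _ _ h => h s⟩
    refine le_trans ?_ ((BoundedContinuousFunction.norm_coe_le_norm _ x₀).trans h3)
    simp [coeff_apply, ψ]
  have h4 := m.le_opNorm_of_le h2
  rw [map_sub, map_smul, hm.map_one, hhker ψ, zero_sub, norm_neg, smul_eq_mul, mul_one] at h4
  have h5 : ‖m‖ * ((1 - r) / (2 * (‖m‖ + 1))) ≤ (1 - r) / 2 := by
    rw [mul_div_assoc', div_le_div_iff₀ (by positivity) (by positivity)]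
    nlinarith [norm_nonneg m]
  have h6 : (1 : ℝ) ≤ ‖(1 : ℂ) - L h x₀‖ + ‖L h x₀‖ := by
    simpa using norm_add_le ((1 : ℂ) - L h x₀) (L h x₀)
  linarith

/-- A normalized invariant functional on `AP(K)` gives rise to an invariant mean. -/
theorem IsInvariantFunctional.isLeftAmenableAP [Nonempty K] {m : StrongDual ℂ S.AP}
    (hm : S.IsInvariantFunctional m) : S.IsLeftAmenableAP := by
  let e : S.AP := ⟨1, S.one_mem_AP⟩
  have he : ‖e‖ = 1 := by
    change ‖(1 : K →ᵇ ℂ)‖ = 1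
    exact norm_one
  let W := coeffKernel m
  have hle : ∀ f : S.AP, ‖W.mkQ f‖ ≤ ‖f‖ := fun f => Submodule.Quotient.norm_mk_le W f
  have hq : ‖W.mkQ e‖ = 1 := by
    refine le_antisymm ((hle e).trans he.le) ?_
    refine le_of_forall_pos_le_add fun ε hε => ?_
    -- Any representative of the class of `1` is `1` minus a kernel element, so it has norm at least
    -- `1`.
    obtain ⟨f, hf, hfn⟩ := Submodule.Quotient.norm_mk_lt (W.mkQ e) hε
    have h1 : e - f ∈ W := by
      rw [← Submodule.Quotient.eq]
      exact hf.symm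
    have h2 := hm.one_le_norm_one_sub h1
    have h3 : (1 : K →ᵇ ℂ) - ((e - f : S.AP) : K →ᵇ ℂ) = f := by
      simp [e]
    rw [h3] at h2
    exact h2.trans hfn.le
  obtain ⟨φ, hφ, hφe⟩ := exists_dual_vector ℂ (W.mkQ e) (by rw [hq]; exact one_ne_zero)
  let M : StrongDual ℂ S.AP := LinearMap.mkContinuous (φ.toLinearMap ∘ₗ W.mkQ) 1 fun f => by
    rw [one_mul]
    refine (φ.le_opNorm _).trans ?_
    rw [hφ, one_mul]
    exact hle f
  have hM : ∀ f, M f = φ (W.mkQ f) := fun _ => rfl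
  have hMe : M e = 1 := by
    rw [hM, hφe, hq]
    simp
  refine ⟨M, ⟨le_antisymm (LinearMap.mkContinuous_norm_le _ zero_le_one _) ?_, hMe⟩, fun x f =>
    ⟨S.translateAP x f, rfl, ?_⟩⟩
  · have := M.le_opNorm e
    rwa [hMe, he, mul_one, norm_one] at this
  · rw [hM, hM, ← sub_eq_zero, ← map_sub, ← map_sub]
    have : W.mkQ (S.translateAP x f - f) = 0 :=
      (Submodule.Quotient.mk_eq_zero W).mpr (hm.sub_translate_mem_coeffKernel x f)
    rw [this, map_zero]

end SemitopologicalSemihypergroup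

/-! ### The shifted adjoint action on the dual of `AP(K)`. -/

/-- A weak* compact set in the dual of a Banach space is norm bounded. -/
theorem WeakDual.exists_forall_norm_apply_le_of_isCompact {X : Type*} [NormedAddCommGroup X]
    [NormedSpace ℂ X] [CompleteSpace X] {C : Set (WeakDual ℂ X)} (hC : IsCompact C) :
    ∃ R : ℝ, 0 < R ∧ ∀ u ∈ C, ∀ φ, ‖u φ‖ ≤ R * ‖φ‖ := by
  obtain ⟨R, hR⟩ := banach_steinhaus (g := fun u : C => WeakDual.toStrongDual u.1) fun φ => by
    obtain ⟨M, hM⟩ := (hC.image (WeakDual.eval_continuous φ)).isBounded.exists_norm_le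
    exact ⟨M, fun u => hM _ ⟨u.1, u.2, rfl⟩⟩
  refine ⟨max R 1, lt_max_of_lt_right one_pos, fun u hu φ => ?_⟩
  refine ((WeakDual.toStrongDual u).le_opNorm φ).trans ?_
  gcongr
  exact (hR ⟨u, hu⟩).trans (le_max_left _ _)

theorem WeakDual.isEquicontinuousAction_of_forall_apply {K X : Type*} [NormedAddCommGroup X]
    [NormedSpace ℂ X] {π : K → WeakDual ℂ X → WeakDual ℂ X}
    (h : ∀ C : Set (WeakDual ℂ X), IsCompact C → ∀ x ∈ C, ∀ φ : X, ∀ ε > 0,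
      ∃ V ∈ 𝓝 (0 : WeakDual ℂ X), ∀ y ∈ C, y - x ∈ V → ∀ s : K, ‖(π s y - π s x) φ‖ < ε) :
    IsEquicontinuousAction π := by
  intro C hC x hx U hU
  obtain ⟨F, ε, hε, hFU⟩ := ((WeakDual.withSeminorms ℂ X).mem_nhds_iff 0 U).mp hU
  choose V hV hVF using fun φ => h C hC x hx φ ε hε
  refine ⟨⋂ φ ∈ F, V φ, (Filter.biInter_finset_mem F).mpr fun φ _ => hV φ, fun y hy hyx s => ?_⟩
  refine hFU ?_
  rw [Seminorm.mem_ball, sub_zero]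
  refine Seminorm.finset_sup_apply_lt hε fun φ hφ => ?_
  exact hVF φ y hy (Set.mem_iInter₂.mp hyx φ hφ) s

namespace SemitopologicalSemihypergroup

/-- The affine action `u ↦ T_s* (u + (1 - u(e)) m₀) - (1 - u(e)) m₀` on the dual of `X`: on each
hyperplane `u(e) = c` it is conjugate to the adjoint action on the hyperplane `u(e) = 1`. -/
noncomputable def shiftedAdjoint {K X : Type*} [NormedAddCommGroup X] [NormedSpace ℂ X]
    (T : K → X →L[ℂ] X) (e : X) (m₀ : StrongDual ℂ X) (s : K) (u : WeakDual ℂ X) : WeakDual ℂ X :=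
  StrongDual.toWeakDual ((WeakDual.toStrongDual u).comp (T s) + (1 - u e) • (m₀.comp (T s) - m₀))

theorem shiftedAdjoint_apply {K X : Type*} [NormedAddCommGroup X] [NormedSpace ℂ X]
    (T : K → X →L[ℂ] X) (e : X) (m₀ : StrongDual ℂ X) (s : K) (u : WeakDual ℂ X) (φ : X) :
    shiftedAdjoint T e m₀ s u φ = u (T s φ) + (1 - u e) * (m₀ (T s φ) - m₀ φ) := rfl

/-- The vectors `T s φ` form a totally bounded set and weak* compact sets are norm bounded, so
finitely many evaluations control `y - x` on all of them. The shift adds only the evaluation at `e`.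
-/
theorem isEquicontinuousAction_shiftedAdjoint {K X : Type*} [NormedAddCommGroup X] [NormedSpace ℂ X]
    [CompleteSpace X] (T : K → X →L[ℂ] X) (e : X) (m₀ : StrongDual ℂ X)
    (hnorm : ∀ s φ, ‖T s φ‖ ≤ ‖φ‖) (hT : ∀ φ, TotallyBounded (Set.range fun s => T s φ)) :
    IsEquicontinuousAction (shiftedAdjoint T e m₀) := by
  refine WeakDual.isEquicontinuousAction_of_forall_apply fun C hC x hx φ ε hε => ?_
  obtain ⟨R, hR0, hR⟩ := WeakDual.exists_forall_norm_apply_le_of_isCompact hC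
  -- Since `y - x` has norm at most `2 * R`, replacing `T s φ` by a net point costs at most `ε / 3`.
  obtain ⟨t, ht, htcov⟩ := Metric.totallyBounded_iff.mp (hT φ) (ε / (6 * R)) (by positivity)
  lift t to Finset X using ht
  have hV : ∀ (ψ : X) (r : ℝ), 0 < r → {w : WeakDual ℂ X | ‖w ψ‖ < r} ∈ 𝓝 0 := fun ψ r hr =>
    (isOpen_lt (WeakDual.eval_continuous ψ).norm continuous_const).mem_nhds (by
      change ‖(0 : ℂ)‖ < r
      simpa using hr)
  have hc : 0 < 2 * ‖m₀‖ * ‖φ‖ + 1 := by positivity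
  set c := 2 * ‖m₀‖ * ‖φ‖ + 1 with hcdef
  refine ⟨{w | ‖w e‖ < ε / (3 * c)} ∩ ⋂ z ∈ t, {w | ‖w z‖ < ε / 3},
    Filter.inter_mem (hV e _ (by positivity))
      ((Filter.biInter_finset_mem t).mpr fun z _ => hV z _ (by positivity)), ?_⟩
  rintro y hy ⟨hye, hyt⟩ s
  obtain ⟨z, hz, hsz⟩ := Set.mem_iUnion₂.mp (htcov ⟨s, rfl⟩)
  have h1 : ‖(y - x) z‖ < ε / 3 := Set.mem_iInter₂.mp hyt z hz
  have h2 : ‖(y - x) (T s φ - z)‖ ≤ ε / 3 := by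
    rw [Metric.mem_ball, dist_eq_norm] at hsz
    have h3 : (y - x) (T s φ - z) = y (T s φ - z) - x (T s φ - z) := rfl
    rw [h3]
    calc _ ≤ ‖y (T s φ - z)‖ + ‖x (T s φ - z)‖ := norm_sub_le _ _
      _ ≤ R * (ε / (6 * R)) + R * (ε / (6 * R)) :=
        add_le_add ((hR y hy _).trans (by gcongr)) ((hR x hx _).trans (by gcongr))
      _ = ε / 3 := by field_simp; ring
  have h4 : ‖(y - x) e * (m₀ (T s φ) - m₀ φ)‖ < ε / 3 := by
    have h5 : ‖m₀ (T s φ) - m₀ φ‖ ≤ c := by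
      have h6 := (m₀.le_opNorm (T s φ)).trans
        (mul_le_mul_of_nonneg_left (hnorm s φ) (norm_nonneg m₀))
      have h7 := m₀.le_opNorm φ
      have h8 := norm_sub_le (m₀ (T s φ)) (m₀ φ)
      linarith
    rw [norm_mul]
    calc _ ≤ ‖(y - x) e‖ * c := by gcongr
      _ < ε / (3 * c) * c := by gcongr; exact hye
      _ = ε / 3 := by field_simp
  have h9 : (shiftedAdjoint T e m₀ s y - shiftedAdjoint T e m₀ s x) φ =
      (y - x) (T s φ - z) + (y - x) z - (y - x) e * (m₀ (T s φ) - m₀ φ) := by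
    have h10 : (y - x) (T s φ - z) + (y - x) z = (y - x) (T s φ) := by
      rw [← map_add, sub_add_cancel]
    rw [h10]
    change shiftedAdjoint T e m₀ s y φ - shiftedAdjoint T e m₀ s x φ =
      y (T s φ) - x (T s φ) - (y e - x e) * (m₀ (T s φ) - m₀ φ)
    rw [shiftedAdjoint_apply, shiftedAdjoint_apply]
    ring
  rw [h9]
  have h11 := norm_sub_le ((y - x) (T s φ - z) + (y - x) z) ((y - x) e * (m₀ (T s φ) - m₀ φ))
  have h12 := norm_add_le ((y - x) (T s φ - z)) ((y - x) z)
  linarith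

variable {K : Type*} [TopologicalSpace K] [T2Space K] [LocallyCompactSpace K]
    [MeasurableSpace K] [BorelSpace K]

/-- A fixed point of the shifted adjoint action is, up to a shift, an invariant functional. -/
theorem exists_invariant_functional_of_fixedPoint (S : SemitopologicalSemihypergroup K)
    {X : Type*} [NormedAddCommGroup X]
    [NormedSpace ℂ X] [CompleteSpace X] (T : K → X →L[ℂ] X) (e : X) (m₀ : StrongDual ℂ X)
    (hnorm : ∀ s φ, ‖T s φ‖ ≤ ‖φ‖) (hT : ∀ φ, TotallyBounded (Set.range fun s => T s φ))
    (hcont : ∀ φ, Continuous fun s => T s φ) (hTe : ∀ s, T s e = e) (hm₀ : m₀ e = 1)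
    (hcomp : ∀ (s t : K) φ, T t (T s φ) = ∫ ζ, T ζ φ ∂S.convMeasure s t)
    (hid : ∀ a, S.IsTwoSidedIdentity a → ∀ φ, T a φ = φ)
    (hfix : ∀ π : K → WeakDual ℂ X → WeakDual ℂ X,
        S.IsDualAction π → IsSeparatelyContinuousAction π → IsEquicontinuousAction π →
        IsAffineAction π →
        (∃ ω₀ : WeakDual ℂ X, Bornology.IsBounded (Set.range fun s : K => π s ω₀)) →
        ∃ x₀ : WeakDual ℂ X, ∀ s : K, π s x₀ = x₀) :
    ∃ m : StrongDual ℂ X, m e = 1 ∧ ∀ s φ, m (T s φ) = m φ := by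
  have hint : ∀ (s t : K) φ, Integrable (fun ζ => T ζ φ) (S.convMeasure s t) := fun s t φ =>
    (hcont φ).integrable_of_totallyBounded_range (hT φ) _
  have hx : ∃ x₀, ∀ s, shiftedAdjoint T e m₀ s x₀ = x₀ := by
    refine hfix _ ?_ ?_ (isEquicontinuousAction_shiftedAdjoint T e m₀ hnorm hT) ?_ ?_
    · constructor
      · intro s t u φ
        have h1 : Integrable (fun ζ => u (T ζ φ)) (S.convMeasure s t) :=
          (WeakDual.toStrongDual u).integrable_comp (hint s t φ)
        have h2 : Integrable (fun ζ => m₀ (T ζ φ)) (S.convMeasure s t) :=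
          m₀.integrable_comp (hint s t φ)
        have h3 : Integrable (fun ζ => (1 - u e) * (m₀ (T ζ φ) - m₀ φ)) (S.convMeasure s t) :=
          (h2.sub (integrable_const _)).const_mul _
        have h4 : u (T t (T s φ)) = ∫ ζ, u (T ζ φ) ∂S.convMeasure s t := by
          rw [hcomp]
          exact ((WeakDual.toStrongDual u).integral_comp_comm (hint s t φ)).symm
        have h5 : m₀ (T t (T s φ)) = ∫ ζ, m₀ (T ζ φ) ∂S.convMeasure s t := by
          rw [hcomp]
          exact (m₀.integral_comp_comm (hint s t φ)).symm
        refine ⟨h1.add h3, ?_⟩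
        simp only [shiftedAdjoint_apply]
        rw [integral_add h1 h3, integral_const_mul, integral_sub h2 (integrable_const _), ← h4, ← h5,
          integral_const, probReal_univ, one_smul, hTe]
        ring
      · intro a ha u
        refine DFunLike.ext _ _ fun φ => ?_
        rw [shiftedAdjoint_apply, hid a ha]
        ring
    · constructor
      · intro s
        refine WeakDual.continuous_of_continuous_eval fun φ => ?_
        simp only [shiftedAdjoint_apply]
        exact (WeakDual.eval_continuous _).add
          ((continuous_const.sub (WeakDual.eval_continuous e)).mul continuous_const)
      · intro u
        refine WeakDual.continuous_of_continuous_eval fun φ => ?_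
        simp only [shiftedAdjoint_apply]
        exact ((WeakDual.toStrongDual u).continuous.comp (hcont φ)).add
          (continuous_const.mul ((m₀.continuous.comp (hcont φ)).sub continuous_const))
    · intro s u v a b ha hb hab
      have hab' : (a : ℂ) + b = 1 := by exact_mod_cast hab
      refine DFunLike.ext _ _ fun φ => ?_
      change (a * u (T s φ) + b * v (T s φ)) + (1 - (a * u e + b * v e)) * (m₀ (T s φ) - m₀ φ) =
        a * (u (T s φ) + (1 - u e) * (m₀ (T s φ) - m₀ φ)) +
        b * (v (T s φ) + (1 - v e) * (m₀ (T s φ) - m₀ φ))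
      linear_combination (-(m₀ (T s φ) - m₀ φ)) * hab'
    -- The orbit of `0` consists of the functionals `m₀ ∘ T s - m₀`.
    · refine ⟨0, (WeakDual.isBounded_closedBall (0 : StrongDual ℂ X) (2 * ‖m₀‖)).subset ?_⟩
      rintro _ ⟨s, rfl⟩
      rw [Set.mem_preimage, mem_closedBall_zero_iff]
      refine ContinuousLinearMap.opNorm_le_bound _ (by positivity) fun φ => ?_
      change ‖(0 : ℂ) + (1 - 0) * (m₀ (T s φ) - m₀ φ)‖ ≤ _
      rw [zero_add, sub_zero, one_mul]
      have h6 := (m₀.le_opNorm (T s φ)).trans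
        (mul_le_mul_of_nonneg_left (hnorm s φ) (norm_nonneg m₀))
      have h7 := m₀.le_opNorm φ
      have h8 := norm_sub_le (m₀ (T s φ)) (m₀ φ)
      linarith
  obtain ⟨x₀, hx₀⟩ := hx
  -- Undoing the conjugation carries the fixed point to the hyperplane of functionals with value `1`
  -- at `e`.
  refine ⟨WeakDual.toStrongDual x₀ + (1 - x₀ e) • m₀, ?_, fun s φ => ?_⟩
  · change x₀ e + (1 - x₀ e) * m₀ e = 1
    rw [hm₀]
    ring
  · have h := congrArg (fun u : WeakDual ℂ X => u φ) (hx₀ s)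
    simp only [shiftedAdjoint_apply] at h
    change x₀ (T s φ) + (1 - x₀ e) * m₀ (T s φ) = x₀ φ + (1 - x₀ e) * m₀ φ
    linear_combination h

/-- The left translation `L_x` as an operator on `AP(K)`, lifted to a higher universe. -/
noncomputable def translateULift {K : Type u} [TopologicalSpace K] [T2Space K]
    [LocallyCompactSpace K] [MeasurableSpace K] [BorelSpace K]
    (S : SemitopologicalSemihypergroup K) (x : K) : ULift.{v} S.AP →L[ℂ] ULift.{v} S.AP :=
  LinearMap.mkContinuous
    { toFun := fun f => ULift.up (S.translateAP x f.down)
      map_add' := fun f g => ULift.ext _ _ (Subtype.ext (map_add (S.translate x) _ _))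
      map_smul' := fun c f => ULift.ext _ _ (Subtype.ext (map_smul (S.translate x) _ _)) }
    1 fun f => by
      rw [one_mul]
      exact S.norm_translate_apply_le x f.down

theorem isLeftAmenableAP_of_fixedPoint {K : Type u} [TopologicalSpace K] [T2Space K]
    [LocallyCompactSpace K] [Nonempty K] [MeasurableSpace K] [BorelSpace K]
    (S : SemitopologicalSemihypergroup K)
    (hfix : ∀ (X : Type (max u v)) [NormedAddCommGroup X] [NormedSpace ℂ X] [CompleteSpace X]
        (π : K → WeakDual ℂ X → WeakDual ℂ X),
        S.IsDualAction π → IsSeparatelyContinuousAction π → IsEquicontinuousAction π →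
        IsAffineAction π →
        (∃ ω₀ : WeakDual ℂ X, Bornology.IsBounded (Set.range fun s : K => π s ω₀)) →
        ∃ x₀ : WeakDual ℂ X, ∀ s : K, π s x₀ = x₀) : S.IsLeftAmenableAP := by
  obtain ⟨y₀⟩ := ‹Nonempty K›
  -- `AP(K)` lives in universe `u`; an isometric copy in `max u v` is within reach of the
  -- hypothesis. A point evaluation then serves as `m₀`.
  let up : S.AP ≃ₗᵢ[ℂ] ULift.{v} S.AP :=
    { ULift.moduleEquiv.symm with norm_map' := fun _ => rfl }
  have : CompleteSpace (ULift.{v} S.AP) := up.symm.toIsometryEquiv.completeSpace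
  let incl : ULift.{v} S.AP →L[ℂ] (K →ᵇ ℂ) :=
    S.AP.subtypeL.comp (up.symm.toContinuousLinearEquiv : ULift.{v} S.AP →L[ℂ] S.AP)
  have hincl : IsUniformInducing incl :=
    (isUniformInducing_val _).comp up.symm.isometry.isUniformInducing
  have hcont : ∀ φ : ULift.{v} S.AP, Continuous fun s => S.translateULift s φ := fun φ =>
    hincl.isInducing.continuous_iff.mpr (continuous_translate φ.down.2)
  have htb : ∀ φ : ULift.{v} S.AP, TotallyBounded (Set.range fun s => S.translateULift s φ) := by
    intro φ
    rw [← totallyBounded_image_iff hincl, ← Set.range_comp]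
    exact S.mem_AP_iff.mp φ.down.2
  obtain ⟨m, hm1, hm⟩ := S.exists_invariant_functional_of_fixedPoint (X := ULift.{v} S.AP)
    S.translateULift (up ⟨1, S.one_mem_AP⟩)
    ((BoundedContinuousFunction.evalCLM ℂ y₀).comp incl)
    (fun s φ => S.norm_translate_apply_le s φ.down)
    htb hcont
    (fun s => ULift.ext _ _ (Subtype.ext (S.translate_one s))) rfl
    (fun s t φ => by
      have h1 := translate_translate φ.down.2 s t
      have h2 := incl.integral_comp_comm
        ((hcont φ).integrable_of_totallyBounded_range (htb φ) (S.convMeasure s t))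
      exact ULift.ext _ _ (Subtype.ext (h1.trans h2)))
    (fun a ha φ => ULift.ext _ _ (Subtype.ext (S.translate_of_isTwoSidedIdentity ha _)))
    (hfix _)
  have hm' : S.IsInvariantFunctional
      (m.comp (up.toContinuousLinearEquiv : S.AP →L[ℂ] ULift.{v} S.AP)) :=
    ⟨hm1, fun x f => hm x (up f)⟩
  exact @IsInvariantFunctional.isLeftAmenableAP _ _ _ _ _ _ S ⟨y₀⟩ _ hm'

end SemitopologicalSemihypergroup

/-! ### Affine functions, means and coefficients of bounded orbits. -/

/-- A weak* continuous real function on a dual space that preserves midpoints is, up to a constant,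
the real part of an evaluation. -/
theorem WeakDual.exists_eq_add_re_apply {X : Type*} [NormedAddCommGroup X] [NormedSpace ℂ X]
    {G : WeakDual ℂ X → ℝ} (hG : Continuous G)
    (hmid : ∀ u v, G (((1 / 2 : ℝ) : ℂ) • u + ((1 / 2 : ℝ) : ℂ) • v) = (G u + G v) / 2) :
    ∃ ψ : X, ∀ u, G u = G 0 + (u ψ).re := by
  have : IsScalarTower ℝ ℂ (WeakDual ℂ X) :=
    ⟨fun a c u => DFunLike.ext _ _ fun φ => smul_assoc a c (u φ)⟩
  -- After subtraction of `G 0`, midpoint preservation gives additivity and continuity gives real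
  -- linearity. The complex extension is weak* continuous, hence an evaluation.
  let ℓ : WeakDual ℂ X →+ ℝ := AddMonoidHom.ofMapMidpoint ℝ ℝ (fun u => G u - G 0) (sub_self _) (by
    intro u v
    have h : midpoint ℝ u v = ((1 / 2 : ℝ) : ℂ) • u + ((1 / 2 : ℝ) : ℂ) • v := by
      rw [midpoint_eq_smul_add, smul_add]
      refine DFunLike.ext _ _ fun φ => ?_
      change (⅟2 : ℝ) • u φ + (⅟2 : ℝ) • v φ = ((1 / 2 : ℝ) : ℂ) * u φ + ((1 / 2 : ℝ) : ℂ) * v φ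
      simp
    rw [h, hmid, midpoint_eq_smul_add, invOf_eq_inv, smul_eq_mul]
    ring)
  let ℓc : StrongDual ℝ (WeakDual ℂ X) := ℓ.toRealLinearMap (hG.sub continuous_const)
  obtain ⟨ψ, hψ⟩ := LinearMap.dualEmbedding_surjective (topDualPairing ℂ X)
    (StrongDual.extendRCLike (𝕜 := ℂ) ℓc)
  refine ⟨ψ, fun u => ?_⟩
  have h1 : u ψ = StrongDual.extendRCLike (𝕜 := ℂ) ℓc u := by
    rw [← hψ]
    rfl
  have h2 : (u ψ).re = G u - G 0 := by
    rw [h1]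
    exact StrongDual.re_extendRCLike_apply (𝕜 := ℂ) ℓc u
  rw [h2]
  ring

namespace SemitopologicalSemihypergroup

variable {K : Type*} [TopologicalSpace K] [T2Space K] [LocallyCompactSpace K]
    [MeasurableSpace K] [BorelSpace K] {S : SemitopologicalSemihypergroup K}

/-- A mean takes purely imaginary values at purely imaginary functions. -/
theorem IsMean.re_apply_eq_zero {m : StrongDual ℂ S.AP} (hm : S.IsMean m) {h : S.AP}
    (hh : ∀ s, ((h : K →ᵇ ℂ) s).re = 0) : (m h).re = 0 := by
  -- For imaginary-valued `h`, the norm of `t + h` is at most `√(t² + ‖h‖²)`. A nonzero `Re m(h)`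
  -- would contribute a term linear in `t` to the square; the `t` chosen below makes it `‖h‖² + 1`.
  have key : ∀ t : ℝ, (t + (m h).re) ^ 2 ≤ t ^ 2 + ‖h‖ ^ 2 := by
    intro t
    have h1 : ‖(t : ℂ) • (⟨1, S.one_mem_AP⟩ : S.AP) + h‖ ≤ √(t ^ 2 + ‖h‖ ^ 2) := by
      change ‖(t : ℂ) • (1 : K →ᵇ ℂ) + (h : K →ᵇ ℂ)‖ ≤ _
      rw [BoundedContinuousFunction.norm_le (Real.sqrt_nonneg _)]
      intro s
      refine Real.le_sqrt_of_sq_le ?_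
      have h2 : ((t : ℂ) • (1 : K →ᵇ ℂ) + (h : K →ᵇ ℂ)) s = t + (h : K →ᵇ ℂ) s := by simp
      have h3 : ‖(h : K →ᵇ ℂ) s‖ ≤ ‖h‖ := (h : K →ᵇ ℂ).norm_coe_le_norm s
      have h4 : ‖(t : ℂ) + (h : K →ᵇ ℂ) s‖ ^ 2 = t ^ 2 + ‖(h : K →ᵇ ℂ) s‖ ^ 2 := by
        rw [Complex.sq_norm, Complex.sq_norm, Complex.normSq_apply, Complex.normSq_apply]
        simp [hh s]
        ring
      rw [h2, h4]
      gcongr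
    have h5 := m.le_opNorm_of_le h1
    rw [map_add, map_smul, hm.2, hm.1, one_mul, smul_eq_mul, mul_one] at h5
    have h6 : |t + (m h).re| ≤ √(t ^ 2 + ‖h‖ ^ 2) := by
      refine le_trans ?_ h5
      have := Complex.abs_re_le_norm ((t : ℂ) + m h)
      simpa using this
    calc (t + (m h).re) ^ 2 = |t + (m h).re| ^ 2 := (sq_abs _).symm
      _ ≤ √(t ^ 2 + ‖h‖ ^ 2) ^ 2 := by gcongr
      _ = _ := Real.sq_sqrt (by positivity)
  by_contra hne
  have h1 := key ((‖h‖ ^ 2 + 1) / (2 * (m h).re))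
  have h2 : 2 * ((‖h‖ ^ 2 + 1) / (2 * (m h).re)) * (m h).re = ‖h‖ ^ 2 + 1 := by field_simp
  nlinarith [sq_nonneg (m h).re]

theorem IsLeftAmenableAP.exists_mean (hS : S.IsLeftAmenableAP) :
    ∃ m : StrongDual ℂ S.AP, S.IsMean m ∧ ∀ x f, m (S.translateAP x f) = m f := by
  obtain ⟨m, hm, hinv⟩ := hS
  refine ⟨m, hm, fun x f => ?_⟩
  obtain ⟨g, hg, hmg⟩ := hinv x f
  have : S.translateAP x f = g := Subtype.ext (DFunLike.coe_injective hg.symm)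
  rw [this, hmg]

section Action

variable {X : Type*} [NormedAddCommGroup X] [NormedSpace ℂ X]
    {π : K → WeakDual ℂ X → WeakDual ℂ X} {ω₀ : WeakDual ℂ X} {R : ℝ}

/-- The coefficient `s ↦ π(s, ω₀)(φ)` of a bounded orbit. -/
noncomputable def orbitCoeff (hc : Continuous fun s => π s ω₀)
    (hR : ∀ s φ, ‖π s ω₀ φ‖ ≤ R * ‖φ‖) (φ : X) : K →ᵇ ℂ :=
  BoundedContinuousFunction.ofNormedAddCommGroup (fun s => π s ω₀ φ)
    ((WeakDual.eval_continuous φ).comp hc) (R * ‖φ‖) fun s => hR s φ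

theorem IsDualAction.translate_orbitCoeff_apply (hπ : S.IsDualAction π)
    (hc : Continuous fun s => π s ω₀) (hR : ∀ s φ, ‖π s ω₀ φ‖ ≤ R * ‖φ‖) (φ : X) (a s : K) :
    S.translate a (orbitCoeff hc hR φ) s = π a (π s ω₀) φ :=
  (hπ.comp a s ω₀ φ).2.symm

/-- The translate by `a` is `u ↦ π a u φ` read along the orbit. On the compact weak* closure of the
orbit these functions are equicontinuous and uniformly bounded, so Arzelà–Ascoli applies; composing
with the orbit map carries compactness back to `K`. -/
theorem IsDualAction.orbitCoeff_mem_AP (hπ : S.IsDualAction π)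
    (hsep : ∀ s, Continuous (π s)) (heq : IsEquicontinuousAction π)
    (hc : Continuous fun s => π s ω₀) (hR : ∀ s φ, ‖π s ω₀ φ‖ ≤ R * ‖φ‖)
    (hb : Bornology.IsBounded (Set.range fun s => π s ω₀)) (φ : X) :
    orbitCoeff hc hR φ ∈ S.AP := by
  set C := closure (Set.range fun s => π s ω₀) with hCdef
  have hCcpt : IsCompact C :=
    WeakDual.isCompact_of_bounded_of_closed (WeakDual.isBounded_closure hb) isClosed_closure
  have : CompactSpace C := isCompact_iff_compactSpace.mp hCcpt
  let F : K → C →ᵇ ℂ := fun a => BoundedContinuousFunction.mkOfCompact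
    ⟨fun u => π a u φ, (WeakDual.eval_continuous φ).comp ((hsep a).comp continuous_subtype_val)⟩
  have hF : ∀ a u, F a u = π a u φ := fun _ _ => rfl
  -- On the orbit these are values of a translate of the coefficient; density and weak* continuity
  -- of `π a` extend the bound.
  have hbound : ∀ a (u : C), ‖F a u‖ ≤ ‖orbitCoeff hc hR φ‖ := by
    intro a u
    have hcl : IsClosed {u : WeakDual ℂ X | ‖π a u φ‖ ≤ ‖orbitCoeff hc hR φ‖} :=
      isClosed_le ((WeakDual.eval_continuous φ).comp (hsep a)).norm continuous_const
    refine closure_minimal ?_ hcl u.2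
    rintro _ ⟨s, rfl⟩
    change ‖π a (π s ω₀) φ‖ ≤ _
    rw [← hπ.translate_orbitCoeff_apply hc hR]
    exact (BoundedContinuousFunction.norm_coe_le_norm _ s).trans (S.norm_translate_apply_le _ _)
  have hequi : Equicontinuous ((↑) : Set.range F → C → ℂ) := by
    intro x
    rw [Metric.equicontinuousAt_iff_right]
    intro ε hε
    have hU : {w : WeakDual ℂ X | ‖w φ‖ < ε} ∈ 𝓝 0 :=
      (isOpen_lt (WeakDual.eval_continuous φ).norm continuous_const).mem_nhds (by
        change ‖(0 : ℂ)‖ < ε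
        simpa using hε)
    obtain ⟨V, hV, hVU⟩ := heq C hCcpt x x.2 _ hU
    have ht : Filter.Tendsto (fun y : C => (y : WeakDual ℂ X) - x) (𝓝 x) (𝓝 0) := by
      have : Continuous fun y : C => (y : WeakDual ℂ X) - x :=
        continuous_subtype_val.sub continuous_const
      simpa using this.tendsto x
    filter_upwards [ht hV] with y hy
    rintro ⟨_, a, rfl⟩
    rw [dist_comm, dist_eq_norm]
    exact hVU y y.2 hy a
  have hcpt := BoundedContinuousFunction.arzela_ascoli (Metric.closedBall 0 ‖orbitCoeff hc hR φ‖)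
    (isCompact_closedBall _ _) (Set.range F) (by
      rintro _ u ⟨a, rfl⟩
      rw [mem_closedBall_zero_iff]
      exact hbound a u) hequi
  let j : C(K, C) := ⟨fun s => ⟨π s ω₀, subset_closure ⟨s, rfl⟩⟩, hc.subtype_mk _⟩
  refine ⟨_, hcpt.image (BoundedContinuousFunction.continuous_compContinuous j), fun a =>
    ⟨_, ⟨F a, subset_closure ⟨a, rfl⟩, rfl⟩, ?_⟩⟩
  ext s
  exact (hπ.translate_orbitCoeff_apply hc hR φ a s).symm

/-- A mean on `AP(K)`, applied to the coefficients of a bounded orbit. -/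
noncomputable def meanOrbit (m : StrongDual ℂ S.AP) (hc : Continuous fun s => π s ω₀)
    (hR : ∀ s φ, ‖π s ω₀ φ‖ ≤ R * ‖φ‖) (hmem : ∀ φ, orbitCoeff hc hR φ ∈ S.AP) (hR0 : 0 ≤ R) :
    WeakDual ℂ X :=
  StrongDual.toWeakDual (LinearMap.mkContinuous
    { toFun := fun φ => m ⟨orbitCoeff hc hR φ, hmem φ⟩
      map_add' := fun φ φ' => by
        rw [← map_add]
        congr 1
        refine Subtype.ext ?_
        ext s
        exact map_add (π s ω₀) φ φ'
      map_smul' := fun c φ => by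
        rw [RingHom.id_apply, ← map_smul]
        congr 1
        refine Subtype.ext ?_
        ext s
        exact map_smul (π s ω₀) c φ }
    (‖m‖ * R) fun φ => by
      rw [mul_assoc]
      exact m.le_opNorm_of_le
        (BoundedContinuousFunction.norm_ofNormedAddCommGroup_le _ (by positivity) fun s => hR s φ))

theorem meanOrbit_apply (m : StrongDual ℂ S.AP) (hc : Continuous fun s => π s ω₀)
    (hR : ∀ s φ, ‖π s ω₀ φ‖ ≤ R * ‖φ‖) (hmem : ∀ φ, orbitCoeff hc hR φ ∈ S.AP) (hR0 : 0 ≤ R)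
    (φ : X) : meanOrbit m hc hR hmem hR0 φ = m ⟨orbitCoeff hc hR φ, hmem φ⟩ := rfl

/-- A weak* continuous affine function commutes with taking the mean, on the level of real parts. -/
theorem IsMean.re_meanOrbit_eq {m : StrongDual ℂ S.AP} (hm : S.IsMean m)
    (hc : Continuous fun s => π s ω₀) (hR : ∀ s φ, ‖π s ω₀ φ‖ ≤ R * ‖φ‖)
    (hmem : ∀ φ, orbitCoeff hc hR φ ∈ S.AP) (hR0 : 0 ≤ R) {G : WeakDual ℂ X → ℂ}
    (hG : Continuous G)
    (hmid : ∀ u v, G (((1 / 2 : ℝ) : ℂ) • u + ((1 / 2 : ℝ) : ℂ) • v) = (G u + G v) / 2)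
    {k : S.AP} (hk : ∀ s, (k : K →ᵇ ℂ) s = G (π s ω₀)) :
    (G (meanOrbit m hc hR hmem hR0)).re = (m k).re := by
  obtain ⟨ψ, hψ⟩ := WeakDual.exists_eq_add_re_apply (Complex.continuous_re.comp hG) (fun u v => by
    simp only [Function.comp_apply, hmid]
    rw [show (G u + G v) / 2 = (G u + G v) / ((2 : ℝ) : ℂ) by norm_num, Complex.div_ofReal_re,
      Complex.add_re])
  simp only [Function.comp_apply] at hψ
  set c := (G 0).re
  -- Subtracting the constant and the coefficient of `ψ` from `k` leaves a purely imaginary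
  -- function.
  have h := hm.re_apply_eq_zero
    (h := k - (c : ℂ) • ⟨1, S.one_mem_AP⟩ - ⟨orbitCoeff hc hR ψ, hmem ψ⟩) (fun s => by
      change ((k : K →ᵇ ℂ) s - (c : ℂ) * 1 - π s ω₀ ψ).re = 0
      rw [hk]
      simp [hψ (π s ω₀)])
  rw [map_sub, map_sub, map_smul, hm.2, ← meanOrbit_apply m hc hR hmem hR0] at h
  rw [hψ]
  simp only [smul_eq_mul, mul_one, Complex.sub_re, Complex.ofReal_re] at h
  linarith

/-- The imaginary part is the real-part statement for `-i G`. -/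
theorem IsMean.meanOrbit_eq {m : StrongDual ℂ S.AP} (hm : S.IsMean m)
    (hc : Continuous fun s => π s ω₀) (hR : ∀ s φ, ‖π s ω₀ φ‖ ≤ R * ‖φ‖)
    (hmem : ∀ φ, orbitCoeff hc hR φ ∈ S.AP) (hR0 : 0 ≤ R) {G : WeakDual ℂ X → ℂ}
    (hG : Continuous G)
    (hmid : ∀ u v, G (((1 / 2 : ℝ) : ℂ) • u + ((1 / 2 : ℝ) : ℂ) • v) = (G u + G v) / 2)
    {k : S.AP} (hk : ∀ s, (k : K →ᵇ ℂ) s = G (π s ω₀)) :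
    G (meanOrbit m hc hR hmem hR0) = m k := by
  refine Complex.ext (hm.re_meanOrbit_eq hc hR hmem hR0 hG hmid hk) ?_
  have h := hm.re_meanOrbit_eq hc hR hmem hR0 (G := fun u => -Complex.I * G u)
    (continuous_const.mul hG) (fun u v => by rw [hmid]; ring) (k := -Complex.I • k) (fun s => by
      rw [← hk]
      rfl)
  rw [map_smul] at h
  simpa using h

end Action

theorem IsLeftAmenableAP.exists_fixedPoint [Nonempty K] (hS : S.IsLeftAmenableAP) {X : Type*}
    [NormedAddCommGroup X] [NormedSpace ℂ X] {π : K → WeakDual ℂ X → WeakDual ℂ X}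
    (hπ : S.IsDualAction π) (hsep : IsSeparatelyContinuousAction π)
    (heq : IsEquicontinuousAction π) (haff : IsAffineAction π) {ω₀ : WeakDual ℂ X}
    (hb : Bornology.IsBounded (Set.range fun s : K => π s ω₀)) :
    ∃ x₀ : WeakDual ℂ X, ∀ s : K, π s x₀ = x₀ := by
  obtain ⟨m, hm, hinv⟩ := hS.exists_mean
  obtain ⟨R, hRball⟩ := (Metric.isBounded_iff_subset_closedBall (0 : StrongDual ℂ X)).mp hb
  have hn : ∀ s, ‖WeakDual.toStrongDual (π s ω₀)‖ ≤ R := fun s =>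
    mem_closedBall_zero_iff.mp (hRball ⟨s, rfl⟩)
  have hR0 : 0 ≤ R := (norm_nonneg _).trans (hn (Classical.arbitrary K))
  have hR : ∀ s φ, ‖π s ω₀ φ‖ ≤ R * ‖φ‖ := fun s φ =>
    (WeakDual.toStrongDual (π s ω₀)).le_of_opNorm_le (hn s) φ
  have hc := hsep.2 ω₀
  have hmem : ∀ φ, orbitCoeff hc hR φ ∈ S.AP :=
    hπ.orbitCoeff_mem_AP hsep.1 heq hc hR hb
  refine ⟨meanOrbit m hc hR hmem hR0, fun a => DFunLike.ext _ _ fun φ => ?_⟩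
  -- Along the orbit, `u ↦ π a u φ` is the translate by `a` of the coefficient of `φ`, so invariance
  -- of the mean removes `a`.
  rw [hm.meanOrbit_eq hc hR hmem hR0 (G := fun u => π a u φ)
    ((WeakDual.eval_continuous φ).comp (hsep.1 a)) (fun u v => ?_)
    (k := S.translateAP a ⟨orbitCoeff hc hR φ, hmem φ⟩)
    (hπ.translate_orbitCoeff_apply hc hR φ a), hinv, meanOrbit_apply]
  rw [haff a u v (1 / 2) (1 / 2) (by norm_num) (by norm_num) (by norm_num)]
  change ((1 / 2 : ℝ) : ℂ) * π a u φ + ((1 / 2 : ℝ) : ℂ) * π a v φ = _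
  push_cast
  ring

end SemitopologicalSemihypergroup

theorem theorem3p5 {K : Type u} [TopologicalSpace K] [T2Space K] [LocallyCompactSpace K]
    [Nonempty K] [MeasurableSpace K] [BorelSpace K] (S : SemitopologicalSemihypergroup K) :
    S.IsLeftAmenableAP ↔
      ∀ (X : Type (max u v)) [NormedAddCommGroup X] [NormedSpace ℂ X] [CompleteSpace X]
        (π : K → WeakDual ℂ X → WeakDual ℂ X),
        S.IsDualAction π → IsSeparatelyContinuousAction π → IsEquicontinuousAction π →
        IsAffineAction π →
        (∃ ω₀ : WeakDual ℂ X, Bornology.IsBounded (Set.range fun s : K => π s ω₀)) →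
        ∃ x₀ : WeakDual ℂ X, ∀ s : K, π s x₀ = x₀ := by
  constructor
  · rintro hS X _ _ _ π hπ hsep heq haff ⟨ω₀, hb⟩
    exact hS.exists_fixedPoint hπ hsep heq haff hb
  · intro h
    exact S.isLeftAmenableAP_of_fixedPoint.{u, v} h
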